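/- **Notation.** Let $\mathbb D=\{z\in\mathbb C:|z|<1\}$. Let $\mathcal S$ be the class of analytic univalent functions $\varphi$ on $\mathbb D$ with $\varphi(0)=0$, $\varphi'(0)=1$. Let $\mathcal S_H$ be the class of univalent harmonic mappings $f=h+\overline g$ of $\mathbb D$, with $h,g$ analytic in $\mathbb D$ and $h(0)=g(0)=0$, $h'(0)=1$, which are sense-preserving, i.e. $|h'(z)|^2-|g'(z)|^2>0$ for all $z\in\mathbb D$. Let $\mathcal S_H^0=\{f\in\mathcal S_H: f_{\overline z}(0)=0\}$, $$\mathcal S_H^0(\mathcal S)=\{h+\overline g\in\mathcal S_H^0:\ h+e^{i\theta}g\in\mathcal S\ \text{for some}\ \theta\in\mathbb R\},$$ $$\mathcal S_H(\mathcal S)=\{f_0+b\,\overline{f_0}:\ f_0\in\mathcal S_H^0(\mathcal S),\ b\in\mathbb D\}.$$ For $0<|z|=r<1$ let $k_f(z)$ denote the signed curvature at $f(z)$ of the image under $f$ of the circle $|\zeta|=r$ traversed counterclockwise, i.e. of the curve $t\mapsto f(ze^{it})$ at $t=0$. **Theorem.** Let $f\in\mathcal S_H(\mathcal S)$, $b_1=f_{\overline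 z}(0)$ and $\rho=3-2\sqrt2$. Then for every $z$ with $0<|z|=r<1$, $$k_f(z)\le \frac{1+|b_1|}{(1-|b_1|)^2}\left(\frac{1+r}{1-r}\right)^4\frac{r^2+6r+1}{r},$$ $$k_f(z)\ge \frac{1-|b_1|}{(1+|b_1|)^2}\left(\frac{1-r}{1+r}\right)^4\frac{r^2-6r+1}{r}\quad\text{if } 0<r\le\rho,$$ $$k_f(z)\ge \frac{1+|b_1|}{(1-|b_1|)^2}\left(\frac{1+r}{1-r}\right)^4\frac{r^2-6r+1}{r}\quad\text{if } \rho<r<1.$$ Moreover, every $f\in\mathcal S_H(\mathcal S)$ maps the disk $|z|<3-2\sqrt2$ onto a convex domain, and $3-2\sqrt2$ is the radius of convexity of the class $\mathcal S_H(\mathcal S)$: for $0<R\le1$, every $f\in\mathcal S_H(\mathcal S)$ maps $|z|<R$ onto a convex domain if and only if $R\le3-2\sqrt2$. -/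

import Mathlib

open scoped ComplexConjugate

namespace HarmonicUnivalent

/-- The open unit disk of the complex plane. -/
def unitDisk : Set ℂ := Metric.ball 0 1

/-- On the unit disk `f = h + conj g`, where `h` and `g` are analytic there and normalized by
`h 0 = g 0 = 0` and `h' 0 = 1`.  Such `h` and `g` are determined by `f` on the disk. -/
structure IsDecomposition (f h g : ℂ → ℂ) : Prop where
  analytic_part : DifferentiableOn ℂ h unitDisk
  coanalytic_part : DifferentiableOn ℂ g unitDisk
  h_zero : h 0 = 0
  g_zero : g 0 = 0
  deriv_h_zero : deriv h 0 = 1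
  eq_add_conj : ∀ z ∈ unitDisk, f z = h z + conj (g z)

/-- The Wirtinger derivative `∂f/∂z̄ = (f_x + i f_y) / 2`. -/
noncomputable def wirtingerBar (f : ℂ → ℂ) (z : ℂ) : ℂ :=
  (fderiv ℝ f z 1 + Complex.I * fderiv ℝ f z Complex.I) / 2

/-- The class `S` of normalized analytic univalent functions on the unit disk. -/
def classS : Set (ℂ → ℂ) :=
  {φ | DifferentiableOn ℂ φ unitDisk ∧ Set.InjOn φ unitDisk ∧ φ 0 = 0 ∧ deriv φ 0 = 1}

/-- The class `S_H` of normalized harmonic mappings of the unit disk that are sense-preserving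
(the Jacobian `|h'|² - |g'|²` is positive) and univalent. -/
def classSH : Set (ℂ → ℂ) :=
  {f | ∃ h g : ℂ → ℂ, IsDecomposition f h g ∧
    (∀ z ∈ unitDisk, 0 < ‖deriv h z‖ ^ 2 - ‖deriv g z‖ ^ 2) ∧ Set.InjOn f unitDisk}

/-- The class `S_H⁰` of those `f` in `S_H` for which `∂f/∂z̄` vanishes at the origin. -/
def classSH0 : Set (ℂ → ℂ) :=
  {f | f ∈ classSH ∧ wirtingerBar f 0 = 0}

/-- The class `S_H⁰(S)` of those `f = h + conj g` in `S_H⁰` such that `h + e^{iθ} g` belongs to `S`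
for some real `θ`. -/
def classSH0S : Set (ℂ → ℂ) :=
  {f | f ∈ classSH0 ∧ ∃ h g : ℂ → ℂ, IsDecomposition f h g ∧
    ∃ θ : ℝ, (fun z => h z + Complex.exp (θ * Complex.I) * g z) ∈ classS}

/-- The class `S_H(S)` of the functions `f₀ + b conj f₀` with `f₀` in `S_H⁰(S)` and `|b| < 1`. -/
def classSHS : Set (ℂ → ℂ) :=
  {f | ∃ f₀ ∈ classSH0S, ∃ b ∈ unitDisk, ∀ z ∈ unitDisk, f z = f₀ z + b * conj (f₀ z)}

/-- The signed curvature `(x' y'' - y' x'') / (x'² + y'²)^{3/2}` of a plane curve `γ = x + i y`. -/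
noncomputable def signedCurvature (γ : ℝ → ℂ) (t : ℝ) : ℝ :=
  ((deriv γ t).re * (deriv (deriv γ) t).im - (deriv γ t).im * (deriv (deriv γ) t).re)
    / ‖deriv γ t‖ ^ 3

/-- The curvature `k_f(z)`, at the point `f z`, of the image under `f` of the circle
`|ζ| = |z|`, which starts at `z` and is traversed counterclockwise. -/
noncomputable def circleImageCurvature (f : ℂ → ℂ) (z : ℂ) : ℝ :=
  signedCurvature (fun t : ℝ => f (z * Complex.exp (t * Complex.I))) 0

/-- A convex domain: a nonempty open convex subset of the plane. -/
def IsConvexDomain (D : Set ℂ) : Prop :=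
  IsOpen D ∧ D.Nonempty ∧ Convex ℝ D

/-- `R₀` is the radius of convexity of the family `F` of functions on the unit disk: among the
disks `|z| < R` with `0 < R ≤ 1`, those which every member of `F` maps onto a convex domain are
exactly the ones with `R ≤ R₀`. -/
def IsRadiusOfConvexity (F : Set (ℂ → ℂ)) (R₀ : ℝ) : Prop :=
  0 < R₀ ∧ R₀ ≤ 1 ∧ ∀ R : ℝ, 0 < R → R ≤ 1 →
    ((∀ f ∈ F, IsConvexDomain (f '' Metric.ball 0 R)) ↔ R ≤ R₀)

end HarmonicUnivalent

/-! Write f₀ = h + conj g and let S = e^{iθ} g'/h', so that φ = h + e^{iθ} g lies in the class S and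
φ' = h' (1 + S). The numerator of the curvature is the cross product of the velocity and
acceleration of the image circle. It differs from |zh'|² (1 - |S|²)(1 + Re zφ''/φ') by at most 2
|zS'| |zh'|² (`abs_cross_sub_le`). Bieberbach's inequality for the Koebe transforms of φ puts (1 -
r²)(1 + Re zφ''/φ') within 4r of 1 + r², and Schwarz–Pick for S makes the error cost another 2r.
This is the origin of r² ± 6r + 1 (`IsShearPair.cross_bounds`). The other factors come from Koebe
distortion for φ' and from |S| ≤ r. The affine map w ↦ w + b conj w contributes its determinant 1 -
|b|² and a stretching between 1 - |b| and 1 + |b|.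

Bieberbach's inequality itself comes from an area argument for 1/φ with the weight 1/|w|
(`exists_bieberbach_estimate`).

For r ≤ 3 - 2√2 the quadratic r² - 6r + 1 is nonnegative, so the tangent angle of the image circle
is monotone and turns by 2π in total. The curve then lies to the left of each of its tangents, the
maximum principle extends this to the image of the disk, and an open set supported at every frontier
point is convex (`IsShearPair.convex_image_ball`). Beyond this radius the harmonic Koebe function
fails: two conjugate points of its image have a midpoint outside the image
(`not_convex_image_harmonicKoebe`). -/

namespace HarmonicUnivalent

/-! ### Bieberbach's inequality through a weighted area estimate -/

open MeasureTheory Set Metric Filter Topology Real in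
theorem lintegral_annulus {ε r : ℝ} (hε : 0 ≤ ε) (F : ℂ → ENNReal)
    (hF : Measurable ({z : ℂ | ε < ‖z‖ ∧ ‖z‖ < r}.indicator F)) :
    ∫⁻ z in {z : ℂ | ε < ‖z‖ ∧ ‖z‖ < r}, F z =
      ∫⁻ s in Ioo ε r, ENNReal.ofReal s * ∫⁻ θ in Ioo (-π) π, F (circleMap 0 s θ) := by
  have hA : MeasurableSet {z : ℂ | ε < ‖z‖ ∧ ‖z‖ < r} :=
    (isOpen_lt continuous_const continuous_norm).measurableSet.inter
      (isOpen_lt continuous_norm continuous_const).measurableSet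
  rw [← lintegral_indicator hA, ← Complex.lintegral_comp_polarCoord_symm]
  have ht : polarCoord.target = Ioi (0 : ℝ) ×ˢ Ioo (-π) π := rfl
  have hcm : ∀ p : ℝ × ℝ, Complex.polarCoord.symm p = circleMap 0 p.1 p.2 := by
    intro p
    simp [circleMap, Complex.exp_mul_I]
  simp only [hcm, smul_eq_mul]
  rw [ht, Measure.volume_eq_prod, ← Measure.prod_restrict, lintegral_prod]
  · rw [← lintegral_indicator measurableSet_Ioi, ← lintegral_indicator measurableSet_Ioo]
    congr 1
    funext s
    by_cases hs : s ∈ Ioo ε r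
    · have hs0 : 0 < s := hε.trans_lt hs.1
      rw [indicator_of_mem hs, indicator_of_mem (by exact hs0)]
      rw [show ∫⁻ y in Ioo (-π) π, ENNReal.ofReal (s, y).1 * {z : ℂ | ε < ‖z‖ ∧ ‖z‖ < r}.indicator F
        (circleMap 0 (s, y).1 (s, y).2) = ENNReal.ofReal s * ∫⁻ y in Ioo (-π) π,
        {z : ℂ | ε < ‖z‖ ∧ ‖z‖ < r}.indicator F (circleMap 0 s y) from
        lintegral_const_mul' _ _ ENNReal.ofReal_ne_top]
      · congr 1
        refine lintegral_congr fun θ => ?_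
        rw [indicator_of_mem]
        simpa [abs_of_pos hs0] using hs
    · rw [indicator_of_notMem hs]
      by_cases hs0 : 0 < s
      · rw [indicator_of_mem (by exact hs0)]
        rw [lintegral_eq_zero_of_ae_eq_zero]
        refine Eventually.of_forall fun θ => ?_
        simp only [Pi.zero_apply, mul_eq_zero]
        right
        rw [indicator_of_notMem]
        simpa [abs_of_pos hs0] using hs
      · rw [indicator_of_notMem (by exact hs0)]
  · apply Measurable.aemeasurable
    apply Measurable.mul (by fun_prop)
    apply hF.comp
    exact circleMap.continuous.measurable

open MeasureTheory Set Metric Filter Topology Real in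
theorem lintegral_ball_inv_norm_le {R : ℝ} :
    ∫⁻ z in ball (0 : ℂ) R, (ENNReal.ofReal ‖z‖)⁻¹ ≤ ENNReal.ofReal (2 * π * R) := by
  have h1 : ∫⁻ z in ball (0 : ℂ) R, (ENNReal.ofReal ‖z‖)⁻¹ ≤
      ∫⁻ z in {z : ℂ | 0 < ‖z‖ ∧ ‖z‖ < R}, (ENNReal.ofReal ‖z‖)⁻¹ := by
    apply lintegral_mono_set'
    have : ∀ᵐ z : ℂ, z ≠ 0 := by simp [ae_iff]
    filter_upwards [this] with z hz hzR
    exact ⟨norm_pos_iff.2 hz, mem_ball_zero_iff.1 hzR⟩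
  refine h1.trans ?_
  have hA : MeasurableSet {z : ℂ | 0 < ‖z‖ ∧ ‖z‖ < R} :=
    (isOpen_lt continuous_const continuous_norm).measurableSet.inter
      (isOpen_lt continuous_norm continuous_const).measurableSet
  rw [lintegral_annulus le_rfl _ (Measurable.indicator (by fun_prop) hA)]
  have : ∀ s ∈ Ioo 0 R, ENNReal.ofReal s * ∫⁻ θ in Ioo (-π) π,
      (ENNReal.ofReal ‖circleMap 0 s θ‖)⁻¹ = ENNReal.ofReal (2 * π) := by
    intro s hs
    simp only [norm_circleMap_zero, abs_of_pos hs.1, lintegral_const, Measure.restrict_apply_univ,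
      Real.volume_Ioo]
    rw [← mul_assoc, ENNReal.mul_inv_cancel, one_mul]
    · congr 1; ring
    · simpa using hs.1
    · simp
  rw [setLIntegral_congr_fun measurableSet_Ioo this]
  simp only [lintegral_const, Measure.restrict_apply_univ, Real.volume_Ioo]
  rw [← ENNReal.ofReal_mul (by positivity), sub_zero]

open MeasureTheory Set Metric Filter Topology Real in
-- The two disks have equal area, hence so do their parts outside the intersection. The weight is at
-- most 1/R on the part outside `ball 0 R` and at least 1/R on the part inside, so centering at the
-- origin maximizes the integral.
theorem lintegral_ball_inv_norm_le_centered (c : ℂ) {R : ℝ} :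
    ∫⁻ z in ball c R, (ENNReal.ofReal ‖z‖)⁻¹ ≤
      ∫⁻ z in ball (0 : ℂ) R, (ENNReal.ofReal ‖z‖)⁻¹ := by
  have hv : volume (ball c R) = volume (ball (0 : ℂ) R) := by
    rw [Measure.addHaar_ball_center]
  have hd : volume (ball c R \ ball 0 R) = volume (ball (0 : ℂ) R \ ball c R) := by
    rw [← sdiff_inter_self_eq_sdiff,
      ← sdiff_inter_self_eq_sdiff (s := ball (0 : ℂ) R) (t := ball c R),
      measure_sdiff inter_subset_right, measure_sdiff inter_subset_right, inter_comm, hv]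
    · exact (measurableSet_ball.inter measurableSet_ball).nullMeasurableSet
    · exact (measure_lt_top_of_subset inter_subset_right measure_ball_lt_top.ne).ne
    · exact (measurableSet_ball.inter measurableSet_ball).nullMeasurableSet
    · exact (measure_lt_top_of_subset inter_subset_right measure_ball_lt_top.ne).ne
  rw [← lintegral_inter_add_sdiff _ (ball c R) (measurableSet_ball (x := (0 : ℂ)) (ε := R)),
    ← lintegral_inter_add_sdiff _ (ball 0 R) (measurableSet_ball (x := c) (ε := R)), inter_comm]
  refine add_le_add le_rfl ?_
  calc ∫⁻ z in ball c R \ ball 0 R, (ENNReal.ofReal ‖z‖)⁻¹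
      ≤ ∫⁻ z in ball c R \ ball 0 R, (ENNReal.ofReal R)⁻¹ := by
        refine setLIntegral_mono' (measurableSet_ball.diff measurableSet_ball) fun z hz => ?_
        gcongr
        simpa using hz.2
    _ = ∫⁻ z in ball 0 R \ ball c R, (ENNReal.ofReal R)⁻¹ := by
        simp [hd]
    _ ≤ _ := by
        refine setLIntegral_mono' (measurableSet_ball.diff measurableSet_ball) fun z hz => ?_
        gcongr
        have := hz.1
        simp only [mem_ball, dist_zero_right] at this
        exact this.le

open Set Metric Real in
-- The first two terms of Parseval's identity, without power series. With q = q(0) + z d the mixed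
-- term is the real part of an analytic function vanishing at 0, so it averages to zero. The mean
-- value property of d² then bounds the average of |d|² below by |q'(0)|².
theorem norm_sq_add_le_circleAverage {q : ℂ → ℂ} (hq : DifferentiableOn ℂ q (ball 0 1)) {s : ℝ}
    (hs : 0 < s) (hs1 : s < 1) :
    ‖q 0‖ ^ 2 + s ^ 2 * ‖deriv q 0‖ ^ 2 ≤ circleAverage (fun z => ‖q z‖ ^ 2) 0 s := by
  set d := dslope q 0 with hd
  have hdd : DifferentiableOn ℂ d (ball 0 1) :=
    (Complex.differentiableOn_dslope (ball_mem_nhds 0 one_pos)).2 hq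
  have hsub : closedBall (0 : ℂ) |s| ⊆ ball 0 1 :=
    closedBall_subset_ball (by rwa [abs_of_pos hs])
  have hmean : ∀ f : ℂ → ℂ, DifferentiableOn ℂ f (ball 0 1) → circleAverage f 0 s = f 0 :=
    fun f hf => (DifferentiableOn.diffContOnCl (hf.mono (by
      refine Subset.trans ?_ hsub
      exact closure_ball_subset_closedBall))).circleAverage
  have hsph : sphere (0 : ℂ) |s| ⊆ ball 0 1 := sphere_subset_closedBall.trans hsub
  have hdc : ContinuousOn d (sphere 0 |s|) := hdd.continuousOn.mono hsph
  have hqe : ∀ z, q z = q 0 + z * d z := by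
    intro z
    have := sub_smul_dslope q 0 z
    simp only [sub_zero, smul_eq_mul] at this
    rw [hd, this]; ring
  have hkey : ∀ z ∈ sphere (0 : ℂ) |s|, ‖q z‖ ^ 2 =
      (‖q 0‖ ^ 2 + s ^ 2 * ‖d z‖ ^ 2) + (2 * conj (q 0) * (z * d z)).re := by
    intro z hz
    have hz' : ‖z‖ ^ 2 = s ^ 2 := by
      have : ‖z‖ = |s| := by simpa using hz
      rw [this, sq_abs]
    rw [hqe z, ← hz', ← mul_pow, ← norm_mul]
    simp only [← Complex.normSq_eq_norm_sq, Complex.normSq_apply]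
    simp
    ring
  rw [circleAverage_congr_sphere hkey]
  have c1 : CircleIntegrable (fun z => s ^ 2 * ‖d z‖ ^ 2) 0 s := by
    refine ContinuousOn.circleIntegrable' ?_
    fun_prop
  have c0 : CircleIntegrable (fun _ : ℂ => ‖q 0‖ ^ 2) 0 s :=
    ContinuousOn.circleIntegrable' continuousOn_const
  have c2 : CircleIntegrable (fun z => 2 * conj (q 0) * (z * d z)) 0 s := by
    refine ContinuousOn.circleIntegrable' ?_
    fun_prop
  have c3 : CircleIntegrable (fun z => (2 * conj (q 0) * (z * d z)).re) 0 s := by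
    refine ContinuousOn.circleIntegrable' ?_
    exact Complex.continuous_re.comp_continuousOn (by fun_prop)
  rw [circleAverage_fun_add (f₁ := fun z => ‖q 0‖ ^ 2 + s ^ 2 * ‖d z‖ ^ 2) (c0.add c1) c3, circleAverage_fun_add c0 c1, circleAverage_const]
  have h3 : circleAverage (fun z => (2 * conj (q 0) * (z * d z)).re) 0 s = 0 := by
    have := Complex.reCLM.circleAverage_comp_comm c2
    rw [hmean (fun z => 2 * conj (q 0) * (z * d z)) (by fun_prop)] at this
    simpa [Function.comp_def] using this
  have h4 : ‖deriv q 0‖ ^ 2 ≤ circleAverage (fun z => ‖d z‖ ^ 2) 0 s := by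
    have e1 := hmean (fun z => d z ^ 2) (by fun_prop)
    have e2 : ‖circleAverage (fun z => d z ^ 2) 0 s‖ ≤ circleAverage (fun z => ‖d z‖ ^ 2) 0 s := by
      simp only [circleAverage, norm_smul, smul_eq_mul]
      rw [Real.norm_of_nonneg (by positivity)]
      gcongr
      refine (intervalIntegral.norm_integral_le_integral_norm (by positivity)).trans_eq ?_
      simp
    rw [e1] at e2
    simpa [hd] using e2
  have h5 : circleAverage (fun z => s ^ 2 * ‖d z‖ ^ 2) 0 s =
      s ^ 2 * circleAverage (fun z => ‖d z‖ ^ 2) 0 s := by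
    simpa using circleAverage_fun_smul (a := s ^ 2) (f := fun z => ‖d z‖ ^ 2) (c := 0) (R := s)
  rw [h3, h5, add_zero]
  gcongr

open Set Metric in
theorem exists_log_of_ne_zero {f : ℂ → ℂ} {r : ℝ} (hr : 0 < r)
    (hf : DifferentiableOn ℂ f (ball 0 r)) (h0 : ∀ z ∈ ball (0 : ℂ) r, f z ≠ 0) :
    ∃ L : ℂ → ℂ, DifferentiableOn ℂ L (ball 0 r) ∧ L 0 = Complex.log (f 0) ∧
      (∀ z ∈ ball 0 r, f z = Complex.exp (L z)) ∧
      ∀ z ∈ ball 0 r, HasDerivAt L (deriv f z / f z) z := by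
  have hd : DifferentiableOn ℂ (fun z => deriv f z / f z) (ball 0 r) :=
    (hf.deriv isOpen_ball).div hf h0
  obtain ⟨L, hL0, hL⟩ := hd.isExactOn_ball.with_val_at 0 (Complex.log (f 0))
  have h0r : (0 : ℂ) ∈ ball 0 r := mem_ball_self hr
  refine ⟨L, fun z hz => (hL z hz).differentiableAt.differentiableWithinAt, hL0, ?_, hL⟩
  have hder : ∀ z ∈ ball 0 r, HasDerivAt (fun z => f z * Complex.exp (-L z)) 0 z := by
    intro z hz
    have h1 := (hf.differentiableAt (isOpen_ball.mem_nhds hz)).hasDerivAt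
    convert! h1.mul (hL z hz).neg.cexp using 1
    field_simp [h0 z hz]
    ring
  intro z hz
  have hc := (convex_ball (0 : ℂ) r).is_const_of_fderivWithin_eq_zero (𝕜 := ℂ)
    (f := fun z => f z * Complex.exp (-L z))
    (fun w hw => (hder w hw).differentiableAt.differentiableWithinAt)
    (fun w hw => by
      rw [fderivWithin_of_isOpen isOpen_ball hw, (hder w hw).hasFDerivAt.fderiv]
      ext; simp) hz h0r
  simp only [hL0, Complex.exp_neg, Complex.exp_log (h0 0 h0r), mul_inv_cancel₀ (h0 0 h0r)] at hc
  field_simp at hc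
  exact hc

theorem det_restrictScalars_toSpanSingleton (a : ℂ) :
    ((ContinuousLinearMap.toSpanSingleton ℂ a).restrictScalars ℝ).det = ‖a‖ ^ 2 := by
  rw [ContinuousLinearMap.det, ← LinearMap.det_toMatrix Complex.basisOneI, Matrix.det_fin_two]
  simp [LinearMap.toMatrix_apply, ← Complex.normSq_eq_norm_sq, Complex.normSq_apply]

open MeasureTheory Set Metric Filter Topology Real in
-- Up to a factor 4 the integrand is the squared derivative of √ψ. The weight thus gives the area
-- argument for a square root transform without choosing a root.
theorem lintegral_le_of_image_subset_ball {ψ ψ' : ℂ → ℂ} {A : Set ℂ} (hA : MeasurableSet A)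
    (hψ : ∀ z ∈ A, HasDerivAt ψ (ψ' z) z) (hinj : InjOn ψ A) {c : ℂ} {R : ℝ}
    (hsub : ψ '' A ⊆ ball c R) :
    ∫⁻ z in A, ENNReal.ofReal (‖ψ' z‖ ^ 2) * (ENNReal.ofReal ‖ψ z‖)⁻¹ ≤
      ENNReal.ofReal (2 * π * R) := by
  have h := lintegral_image_eq_lintegral_abs_det_fderiv_mul volume hA
    (f' := fun z => (ContinuousLinearMap.toSpanSingleton ℂ (ψ' z)).restrictScalars ℝ)
    (fun z hz => ((hψ z hz).hasFDerivAt.restrictScalars ℝ).hasFDerivWithinAt) hinj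
    (fun w => (ENNReal.ofReal ‖w‖)⁻¹)
  simp only [det_restrictScalars_toSpanSingleton, abs_pow, abs_norm] at h
  rw [← h]
  exact (lintegral_mono_set hsub).trans
    ((lintegral_ball_inv_norm_le_centered c).trans lintegral_ball_inv_norm_le)

open MeasureTheory Set Metric Filter Topology Real in
theorem le_lintegral_annulus_norm_sq {q : ℂ → ℂ} (hq : DifferentiableOn ℂ q (ball 0 1))
    {ε r : ℝ} (hε : 0 < ε) (hεr : ε < r) (hr : r < 1) :
    ENNReal.ofReal (2 * π * (‖q 0‖ ^ 2 * (ε⁻¹ - r⁻¹) + ‖deriv q 0‖ ^ 2 * (r - ε))) ≤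
      ∫⁻ z in {z : ℂ | ε < ‖z‖ ∧ ‖z‖ < r}, ENNReal.ofReal (‖q z‖ ^ 2 / ‖z‖ ^ 3) := by
  have hAo : IsOpen {z : ℂ | ε < ‖z‖ ∧ ‖z‖ < r} :=
    (isOpen_lt continuous_const continuous_norm).inter
      (isOpen_lt continuous_norm continuous_const)
  have hAb : {z : ℂ | ε < ‖z‖ ∧ ‖z‖ < r} ⊆ ball 0 1 := fun z hz => by
    simpa using hz.2.trans hr
  have hqc : ContinuousOn q {z : ℂ | ε < ‖z‖ ∧ ‖z‖ < r} := hq.continuousOn.mono hAb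
  have hmeas : Measurable ({z : ℂ | ε < ‖z‖ ∧ ‖z‖ < r}.indicator
      fun z => ENNReal.ofReal (‖q z‖ ^ 2 / ‖z‖ ^ 3)) := by
    rw [← piecewise_eq_indicator]
    refine ContinuousOn.measurable_piecewise ?_ continuousOn_const hAo.measurableSet
    refine ENNReal.continuous_ofReal.comp_continuousOn ?_
    refine ContinuousOn.div (by fun_prop) (by fun_prop) fun z hz => ?_
    have := hε.trans hz.1
    positivity
  rw [lintegral_annulus hε.le _ hmeas]
  have hin : ∀ s ∈ Ioo ε r, ENNReal.ofReal (2 * π * (‖q 0‖ ^ 2 / s ^ 2 + ‖deriv q 0‖ ^ 2)) ≤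
      ENNReal.ofReal s * ∫⁻ θ in Ioo (-π) π,
        ENNReal.ofReal (‖q (circleMap 0 s θ)‖ ^ 2 / ‖circleMap 0 s θ‖ ^ 3) := by
    intro s hs
    have hs0 : 0 < s := hε.trans hs.1
    have hcont : Continuous fun θ => ‖q (circleMap 0 s θ)‖ ^ 2 / s ^ 3 := by
      have : Continuous fun θ => q (circleMap 0 s θ) := by
        refine hqc.comp_continuous (continuous_circleMap 0 s) fun θ => ?_
        simpa [abs_of_pos hs0] using hs
      exact (this.norm.pow 2).div_const _
    simp only [norm_circleMap_zero, abs_of_pos hs0]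
    rw [← ofReal_integral_eq_lintegral_ofReal, ← ENNReal.ofReal_mul hs0.le]
    · apply ENNReal.ofReal_le_ofReal
      have h1 := norm_sq_add_le_circleAverage hq hs0 (hs.2.trans hr)
      rw [circleAverage_eq_integral_add (-π), intervalIntegral.integral_comp_add_right
        (fun θ => ‖q (circleMap 0 s θ)‖ ^ 2), zero_add,
        show 2 * π + -π = π by ring, intervalIntegral.integral_of_le (by linarith [pi_pos]),
        integral_Ioc_eq_integral_Ioo, smul_eq_mul, inv_mul_eq_div, le_div_iff₀ (by positivity)]
        at h1
      rw [integral_div]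
      set J := ∫ t in Ioo (-π) π, ‖q (circleMap 0 s t)‖ ^ 2
      rw [show s * (J / s ^ 3) = J / s ^ 2 by field_simp, le_div_iff₀ (by positivity)]
      refine le_trans (le_of_eq ?_) h1
      field_simp
    · exact (hcont.integrableOn_Icc (a := -π) (b := π)).mono_set Ioo_subset_Icc_self
    · exact Eventually.of_forall fun θ => by positivity
  refine le_trans ?_ (setLIntegral_mono' measurableSet_Ioo hin)
  have hci : ContinuousOn (fun s : ℝ => 2 * π * (‖q 0‖ ^ 2 / s ^ 2 + ‖deriv q 0‖ ^ 2))
      (Icc ε r) := by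
    refine ContinuousOn.mul continuousOn_const (ContinuousOn.add (ContinuousOn.div
      continuousOn_const (by fun_prop) fun s hs => ?_) continuousOn_const)
    have := hε.trans_le hs.1
    positivity
  rw [← ofReal_integral_eq_lintegral_ofReal]
  · apply ENNReal.ofReal_le_ofReal
    rw [← integral_Ioc_eq_integral_Ioo, ← intervalIntegral.integral_of_le hεr.le]
    rw [intervalIntegral.integral_eq_sub_of_hasDerivAt
      (f := fun s => 2 * π * (‖q 0‖ ^ 2 * (-s⁻¹) + ‖deriv q 0‖ ^ 2 * s))]
    · apply le_of_eq
      ring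
    · intro s hs
      rw [uIcc_of_le hεr.le] at hs
      have hs0 : s ≠ 0 := (hε.trans_le hs.1).ne'
      have h1 := (((hasDerivAt_inv hs0).neg.const_mul (‖q 0‖ ^ 2)).add
        ((hasDerivAt_id s).const_mul (‖deriv q 0‖ ^ 2))).const_mul (2 * π)
      refine h1.congr_deriv ?_
      field_simp
    · exact (hci.mono (by rw [uIcc_of_le hεr.le])).intervalIntegrable
  · exact (hci.integrableOn_Icc).mono_set Ioo_subset_Icc_self
  · exact Eventually.of_forall fun θ => by positivity

open Set Metric Filter Topology Real in
-- The weighted area of the image of the annulus ε < |z| < r under 1/φ is estimated twice. From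
-- above: 1/φ = 1/z + const + O(z), so the image lies in a disk of radius 1/ε + O(ε). From below:
-- the truncated Parseval bound for q. Both estimates carry a factor 2π, which cancels.
theorem exists_bieberbach_estimate {φ : ℂ → ℂ} (hφ : φ ∈ classS) {r : ℝ}
    (hr : r < 1) : ∃ C : ℝ, 0 < C ∧ ∀ ε, 0 < ε → ε < r → C * ε ≤ 1 →
      (ε⁻¹ - r⁻¹) + (‖deriv (deriv φ) 0‖ / 4) ^ 2 * (r - ε) ≤ ε⁻¹ + C * ε := by
  obtain ⟨hd, hinj, h0, h1⟩ := hφ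
  unfold unitDisk at hd hinj
  have h0b : (0 : ℂ) ∈ ball (0 : ℂ) 1 := mem_ball_self one_pos
  have hnb : ball (0 : ℂ) 1 ∈ 𝓝 (0 : ℂ) := ball_mem_nhds 0 one_pos
  have hder : ∀ {f : ℂ → ℂ}, DifferentiableOn ℂ f (ball 0 1) → ∀ {z}, z ∈ ball (0 : ℂ) 1 →
      HasDerivAt f (deriv f z) z := fun hf z hz =>
    (hf.differentiableAt (isOpen_ball.mem_nhds hz)).hasDerivAt
  set m := dslope φ 0 with hm
  have hmd : DifferentiableOn ℂ m (ball 0 1) := (Complex.differentiableOn_dslope hnb).2 hd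
  have hφm : ∀ z, φ z = z * m z := by
    intro z
    have := sub_smul_dslope φ 0 z
    simp only [sub_zero, smul_eq_mul, h0] at this
    rw [hm, this]
  have hm0 : m 0 = 1 := by rw [hm, dslope_same, h1]
  have hmne : ∀ z ∈ ball (0 : ℂ) 1, m z ≠ 0 := by
    intro z hz hmz
    have hz0 : z = 0 := hinj hz h0b (by rw [hφm z, hmz, mul_zero, h0])
    rw [hz0, hm0] at hmz
    exact one_ne_zero hmz
  have hφ' : ∀ z ∈ ball (0 : ℂ) 1, deriv φ z = m z + z * deriv m z := by
    intro z hz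
    have := ((hasDerivAt_id z).mul (hder hmd hz)).deriv
    rw [show φ = id * m from funext hφm]
    simpa using this
  have hφ'' : deriv (deriv φ) 0 = 2 * deriv m 0 := by
    have he : deriv φ =ᶠ[𝓝 0] fun z => m z + z * deriv m z := by
      filter_upwards [hnb] with z hz using hφ' z hz
    rw [he.deriv_eq]
    have := ((hder hmd h0b).add ((hasDerivAt_id (0 : ℂ)).mul
      (hder (hmd.deriv isOpen_ball) h0b))).deriv
    simp only [id, zero_mul, one_mul, add_zero] at this
    refine Eq.trans ?_ (this.trans (two_mul _).symm)
    rfl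
  obtain ⟨Λ, hΛd, hΛ0, hΛe, hΛ'⟩ := exists_log_of_ne_zero one_pos hmd hmne
  rw [hm0, Complex.log_one] at hΛ0
  -- q = φ' (φ/z)^{-3/2}, so |q|²/|z|³ = |φ'|²/|φ|³ is the integrand for 1/φ with weight 1/|w|. Its
  -- Taylor expansion starts with 1 + (φ''(0)/4) z.
  set q : ℂ → ℂ := fun z => deriv φ z * Complex.exp (-(3 / 2) * Λ z) with hq
  have hqd : DifferentiableOn ℂ q (ball 0 1) :=
    (hd.deriv isOpen_ball).mul ((hΛd.const_mul _).cexp)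
  have hq0 : q 0 = 1 := by simp [hq, h1, hΛ0]
  have hq' : deriv q 0 = deriv (deriv φ) 0 / 4 := by
    have := ((hder (hd.deriv isOpen_ball) h0b).mul
      (((hΛ' 0 h0b).const_mul (-(3 / 2) : ℂ)).cexp)).deriv
    simp only [hΛ0, h1, hm0, mul_zero, Complex.exp_zero] at this
    refine Eq.trans this ?_
    rw [hφ'']
    ring
  set n : ℂ → ℂ := fun z => (m z)⁻¹ with hn
  have hnd : DifferentiableOn ℂ n (ball 0 1) := hmd.inv hmne
  have hn0 : n 0 = 1 := by simp [hn, hm0]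
  -- κ/z is the analytic remainder in 1/φ = 1/z + n'(0) + z (κ/z). The constant n'(0) becomes the
  -- center of the disk containing the image.
  set κ : ℂ → ℂ := fun z => dslope n 0 z - deriv n 0 with hκ
  have hκd : DifferentiableOn ℂ κ (ball 0 1) :=
    ((Complex.differentiableOn_dslope hnb).2 hnd).sub_const _
  have hκ0 : κ 0 = 0 := by simp [hκ]
  have hκ1 : DifferentiableOn ℂ (dslope κ 0) (ball 0 1) :=
    (Complex.differentiableOn_dslope hnb).2 hκd
  obtain ⟨C, hC⟩ := (isCompact_closedBall (0 : ℂ) r).exists_bound_of_continuousOn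
    (hκ1.continuousOn.mono (closedBall_subset_ball hr))
  have hinv : ∀ z, z ≠ 0 → (φ z)⁻¹ = deriv n 0 + (z⁻¹ + z * dslope κ 0 z) := by
    intro z hz
    have e1 := sub_smul_dslope κ 0 z
    have e2 := sub_smul_dslope n 0 z
    simp only [sub_zero, smul_eq_mul, hκ0, hn0] at e1 e2
    rw [e1, hφm z, mul_inv, hκ]
    change z⁻¹ * n z = _
    have e3 : n z = 1 + z * dslope n 0 z := by rw [e2]; ring
    rw [e3]
    field_simp
    ring
  refine ⟨max C 1, by positivity, fun ε hε hεr hCε => ?_⟩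
  set A : Set ℂ := {z : ℂ | ε < ‖z‖ ∧ ‖z‖ < r} with hA
  have hAm : MeasurableSet A :=
    ((isOpen_lt continuous_const continuous_norm).inter
      (isOpen_lt continuous_norm continuous_const)).measurableSet
  have hAb : A ⊆ ball 0 1 := fun z hz => by simpa using hz.2.trans hr
  have hA0 : ∀ z ∈ A, z ≠ 0 := fun z hz => norm_pos_iff.1 (hε.trans hz.1)
  have hφne : ∀ z ∈ A, φ z ≠ 0 := fun z hz => by
    rw [hφm z]; exact mul_ne_zero (hA0 z hz) (hmne z (hAb hz))
  have hup := lintegral_le_of_image_subset_ball (ψ := fun z => (φ z)⁻¹)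
    (ψ' := fun z => -deriv φ z / φ z ^ 2) hAm
    (fun z hz => (hder hd (hAb hz)).fun_inv (hφne z hz))
    (fun z hz w hw hzw => hinj (hAb hz) (hAb hw) (inv_injective hzw))
    (c := deriv n 0) (R := ε⁻¹ + max C 1 * ε) (by
      rintro _ ⟨z, hz, rfl⟩
      have hs0 : 0 < ‖z‖ := hε.trans hz.1
      have hs1 : ‖z‖ < 1 := hz.2.trans hr
      simp only [mem_ball, hinv z (hA0 z hz), dist_self_add_left]
      have b1 : ‖z⁻¹ + z * dslope κ 0 z‖ ≤ ‖z‖⁻¹ + ‖z‖ * max C 1 := by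
        refine (norm_add_le _ _).trans ?_
        rw [norm_inv, norm_mul]
        gcongr
        exact (hC z (by simpa using hz.2.le)).trans (le_max_left _ _)
      refine b1.trans_lt ?_
      set s := ‖z‖
      set K := max C 1
      -- The condition C ε ≤ 1 enters here: it makes 1/s + K s smaller than its value at s = ε for
      -- every s in (ε, 1).
      have hKs : K * ε * s < 1 := by nlinarith
      have : ε⁻¹ + K * ε - (s⁻¹ + s * K) = (s - ε) * (1 - K * ε * s) / (ε * s) := by
        field_simp
        ring
      have h2 : 0 < (s - ε) * (1 - K * ε * s) / (ε * s) :=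
        div_pos (mul_pos (sub_pos.2 hz.1) (sub_pos.2 hKs)) (mul_pos hε hs0)
      linarith)
  have hlow := le_lintegral_annulus_norm_sq hqd hε hεr hr
  have heq : ∫⁻ z in A, ENNReal.ofReal (‖q z‖ ^ 2 / ‖z‖ ^ 3) =
      ∫⁻ z in A, ENNReal.ofReal (‖-deriv φ z / φ z ^ 2‖ ^ 2) *
        (ENNReal.ofReal ‖(φ z)⁻¹‖)⁻¹ := by
    refine MeasureTheory.setLIntegral_congr_fun hAm fun z hz => ?_
    have hne := norm_pos_iff.2 (hφne z hz)
    have hz0 := norm_pos_iff.2 (hA0 z hz)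
    have hmz := norm_pos_iff.2 (hmne z (hAb hz))
    rw [norm_inv, ← ENNReal.ofReal_inv_of_pos (by positivity), inv_inv,
      ← ENNReal.ofReal_mul (by positivity)]
    congr 1
    have he : ‖Complex.exp (-(3 / 2) * Λ z)‖ ^ 2 = (‖m z‖ ^ 3)⁻¹ := by
      rw [← norm_pow, ← norm_pow, ← norm_inv, ← Complex.exp_nat_mul, hΛe z (hAb hz),
        ← Complex.exp_nat_mul, ← Complex.exp_neg]
      congr 2
      push_cast
      ring
    rw [hq]
    simp only [norm_mul, norm_div, norm_neg, norm_pow, mul_pow, he, hφm z]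
    field_simp
  have hfin := hlow.trans (heq.le.trans hup)
  rw [ENNReal.ofReal_le_ofReal_iff (by positivity), hq0, hq'] at hfin
  have := le_of_mul_le_mul_left hfin (by positivity)
  simpa using this

open Set Metric Filter Topology in
-- Let ε → 0 in the two-sided area estimate, where the singular terms 1/ε cancel, and then r → 1.
theorem norm_deriv_deriv_le_four {φ : ℂ → ℂ} (hφ : φ ∈ classS) : ‖deriv (deriv φ) 0‖ ≤ 4 := by
  set B := ‖deriv (deriv φ) 0‖ / 4 with hB
  have hB0 : 0 ≤ B := by positivity
  have h1 : ∀ r : ℝ, 0 < r → r < 1 → B ^ 2 * r ≤ r⁻¹ := by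
    intro r hr0 hr
    obtain ⟨C, hC, h⟩ := exists_bieberbach_estimate hφ hr
    have ht : Tendsto (fun ε : ℝ => r⁻¹ + C * ε + B ^ 2 * ε) (𝓝[>] 0)
        (𝓝 (r⁻¹ + C * 0 + B ^ 2 * 0)) :=
      (Continuous.tendsto (by fun_prop) 0).mono_left nhdsWithin_le_nhds
    simp only [mul_zero, add_zero] at ht
    refine ge_of_tendsto ht ?_
    have hr' : Ioo (0 : ℝ) (min r C⁻¹) ∈ 𝓝[>] (0 : ℝ) :=
      Ioo_mem_nhdsGT (by positivity)
    filter_upwards [hr'] with ε hε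
    have := h ε hε.1 (hε.2.trans_le (min_le_left _ _))
      (by
        have := hε.2.le.trans (min_le_right _ _)
        rwa [mul_comm, ← le_div_iff₀ hC, one_div])
    rw [← hB] at this
    linarith
  have h2 : B ^ 2 * 1 ≤ 1⁻¹ := by
    have ht1 : Tendsto (fun r : ℝ => B ^ 2 * r) (𝓝[<] 1) (𝓝 (B ^ 2 * 1)) :=
      (Continuous.tendsto (by fun_prop) 1).mono_left nhdsWithin_le_nhds
    have ht2 : Tendsto (fun r : ℝ => r⁻¹) (𝓝[<] 1) (𝓝 1⁻¹) :=
      (continuousAt_inv₀ one_ne_zero).tendsto.mono_left nhdsWithin_le_nhds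
    refine le_of_tendsto_of_tendsto ht1 ht2 ?_
    filter_upwards [Ioo_mem_nhdsLT (show (0 : ℝ) < 1 by norm_num)] with r hr
    exact h1 r hr.1 hr.2
  have : B ≤ 1 := by nlinarith
  linarith

/-! ### Disk automorphisms, Schwarz–Pick and Koebe distortion -/

/-- The automorphism `ζ ↦ (ζ + a) / (1 + ā ζ)` of the unit disk. -/
noncomputable def diskMoebius (a ζ : ℂ) : ℂ := (ζ + a) / (1 + conj a * ζ)

theorem one_add_conj_mul_ne_zero {a ζ : ℂ} (ha : ‖a‖ < 1) (hζ : ‖ζ‖ < 1) :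
    1 + conj a * ζ ≠ 0 := by
  intro h
  have h1 : conj a * ζ = -1 := by linear_combination h
  have h2 : ‖a‖ * ‖ζ‖ = 1 := by
    rw [← RCLike.norm_conj a, ← norm_mul, h1]; simp
  nlinarith [norm_nonneg a, norm_nonneg ζ]

theorem norm_diskMoebius_lt_one {a ζ : ℂ} (ha : ‖a‖ < 1) (hζ : ‖ζ‖ < 1) :
    ‖diskMoebius a ζ‖ < 1 := by
  have hne := norm_pos_iff.2 (one_add_conj_mul_ne_zero ha hζ)
  rw [diskMoebius, norm_div, div_lt_one hne, ← sq_lt_sq₀ (norm_nonneg _) (norm_nonneg _)]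
  have h1 : ‖1 + conj a * ζ‖ ^ 2 - ‖ζ + a‖ ^ 2 = (1 - ‖a‖ ^ 2) * (1 - ‖ζ‖ ^ 2) := by
    simp only [← Complex.normSq_eq_norm_sq, Complex.normSq_apply]
    simp
    ring
  have h2 : 0 < (1 - ‖a‖ ^ 2) * (1 - ‖ζ‖ ^ 2) := by
    apply mul_pos <;> nlinarith [norm_nonneg a, norm_nonneg ζ]
  linarith

theorem hasDerivAt_diskMoebius {a ζ : ℂ} (ha : ‖a‖ < 1) (hζ : ‖ζ‖ < 1) :
    HasDerivAt (diskMoebius a) ((1 - ‖a‖ ^ 2) / (1 + conj a * ζ) ^ 2) ζ := by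
  have h := ((hasDerivAt_id ζ).add_const a).fun_div
    (((hasDerivAt_id ζ).const_mul (conj a)).const_add 1) (one_add_conj_mul_ne_zero ha hζ)
  refine h.congr_deriv ?_
  congr 1
  simp only [id]
  have : (‖a‖ : ℂ) ^ 2 = conj a * a := (Complex.conj_mul' a).symm
  rw [this]
  ring

theorem injOn_diskMoebius {a : ℂ} (ha : ‖a‖ < 1) :
    Set.InjOn (diskMoebius a) (Metric.ball 0 1) := by
  intro z hz w hw h
  rw [mem_ball_zero_iff] at hz hw
  rw [diskMoebius, diskMoebius, div_eq_div_iff (one_add_conj_mul_ne_zero ha hz)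
    (one_add_conj_mul_ne_zero ha hw)] at h
  have h1 : (1 - conj a * a) * (z - w) = 0 := by linear_combination h
  rw [Complex.conj_mul', mul_eq_zero, sub_eq_zero, sub_eq_zero] at h1
  refine h1.resolve_left fun h2 => ?_
  have h3 : (1 : ℝ) = ‖a‖ ^ 2 := by exact_mod_cast h2
  nlinarith [norm_nonneg a]

theorem diskMoebius_zero (a : ℂ) : diskMoebius a 0 = a := by simp [diskMoebius]

theorem one_sub_norm_sq_ne_zero {a : ℂ} (ha : ‖a‖ < 1) : (1 - (‖a‖ : ℂ) ^ 2) ≠ 0 := by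
  have : (1 - ‖a‖ ^ 2 : ℝ) ≠ 0 := by nlinarith [norm_nonneg a]
  exact_mod_cast this

open Metric Set in
/-- The Schwarz–Pick lemma, infinitesimal form. -/
theorem norm_deriv_mul_le_of_mapsTo_unit_ball {f : ℂ → ℂ}
    (hf : DifferentiableOn ℂ f (ball 0 1)) (hm : MapsTo f (ball 0 1) (ball 0 1)) {a : ℂ}
    (ha : a ∈ ball (0 : ℂ) 1) : ‖deriv f a‖ * (1 - ‖a‖ ^ 2) ≤ 1 - ‖f a‖ ^ 2 := by
  have ha1 : ‖a‖ < 1 := mem_ball_zero_iff.1 ha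
  have hb1 : ‖f a‖ < 1 := mem_ball_zero_iff.1 (hm ha)
  have hb1' : ‖-f a‖ < 1 := by rwa [norm_neg]
  have hT : MapsTo (diskMoebius a) (ball 0 1) (ball 0 1) := fun z hz =>
    mem_ball_zero_iff.2 (norm_diskMoebius_lt_one ha1 (mem_ball_zero_iff.1 hz))
  have hS : MapsTo (diskMoebius (-f a)) (ball 0 1) (ball 0 1) := fun z hz =>
    mem_ball_zero_iff.2 (norm_diskMoebius_lt_one hb1' (mem_ball_zero_iff.1 hz))
  have hTd : DifferentiableOn ℂ (diskMoebius a) (ball 0 1) := fun z hz =>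
    (hasDerivAt_diskMoebius ha1 (mem_ball_zero_iff.1 hz)).differentiableAt.differentiableWithinAt
  have hSd : DifferentiableOn ℂ (diskMoebius (-f a)) (ball 0 1) := fun z hz =>
    (hasDerivAt_diskMoebius hb1' (mem_ball_zero_iff.1 hz)).differentiableAt.differentiableWithinAt
  have hg0 : (diskMoebius (-f a) ∘ f ∘ diskMoebius a) 0 = 0 := by
    simp [diskMoebius]
  have h := Complex.norm_deriv_le_one_of_mapsTo_ball (R := 1) (c := 0)
    (f := diskMoebius (-f a) ∘ f ∘ diskMoebius a) (hSd.comp (hf.comp hTd hT) (hm.comp hT))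
    (by rw [hg0]; exact fun z hz => ball_subset_closedBall (hS (hm (hT hz)))) one_pos
  have hda : HasDerivAt f (deriv f a) (diskMoebius a 0) := by
    rw [diskMoebius_zero]
    exact (hf.differentiableAt (isOpen_ball.mem_nhds ha)).hasDerivAt
  have hdb : HasDerivAt (diskMoebius (-f a)) ((1 - (‖f a‖ : ℂ) ^ 2)⁻¹)
      ((f ∘ diskMoebius a) 0) := by
    have := hasDerivAt_diskMoebius hb1' hb1
    rw [Function.comp_apply, diskMoebius_zero]
    refine this.congr_deriv ?_
    rw [norm_neg, map_neg, neg_mul, Complex.conj_mul', ← sub_eq_add_neg]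
    have := one_sub_norm_sq_ne_zero hb1
    field_simp
  have hd := hdb.comp 0 (hda.comp 0 (hasDerivAt_diskMoebius ha1 (ζ := 0) (by simp)))
  rw [hd.deriv] at h
  have e1 : ‖(1 - (‖a‖ : ℂ) ^ 2)‖ = 1 - ‖a‖ ^ 2 := by
    rw [show (1 - (‖a‖ : ℂ) ^ 2) = ((1 - ‖a‖ ^ 2 : ℝ) : ℂ) by push_cast; rfl,
      Complex.norm_real, Real.norm_of_nonneg (by nlinarith [norm_nonneg a])]
  have e2 : ‖(1 - (‖f a‖ : ℂ) ^ 2)‖ = 1 - ‖f a‖ ^ 2 := by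
    rw [show (1 - (‖f a‖ : ℂ) ^ 2) = ((1 - ‖f a‖ ^ 2 : ℝ) : ℂ) by push_cast; rfl,
      Complex.norm_real, Real.norm_of_nonneg (by nlinarith [norm_nonneg (f a)])]
  simp only [mul_zero, add_zero, one_pow, div_one, norm_mul, norm_inv, e1, e2] at h
  have : 0 < 1 - ‖f a‖ ^ 2 := by nlinarith [norm_nonneg (f a)]
  rwa [inv_mul_le_one₀ this] at h

open Metric Set Filter Topology in
-- The Koebe transform F of φ at a, formed by precomposing with a disk automorphism and
-- renormalizing, is again in the class. The quantity bounded is exactly F''(0).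
theorem norm_preSchwarzian_sub_le {φ : ℂ → ℂ} (hφ : φ ∈ classS)
    (hne : ∀ z ∈ ball (0 : ℂ) 1, deriv φ z ≠ 0) {a : ℂ} (ha : ‖a‖ < 1) :
    ‖(1 - (‖a‖ : ℂ) ^ 2) * (deriv (deriv φ) a / deriv φ a) - 2 * conj a‖ ≤ 4 := by
  obtain ⟨hd, hinj, -, -⟩ := hφ
  unfold unitDisk at hd hinj
  have ha' : a ∈ ball (0 : ℂ) 1 := mem_ball_zero_iff.2 ha
  have hc : (1 - (‖a‖ : ℂ) ^ 2) ≠ 0 := one_sub_norm_sq_ne_zero ha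
  have hφa := hne a ha'
  have hT : MapsTo (diskMoebius a) (ball 0 1) (ball 0 1) := fun z hz =>
    mem_ball_zero_iff.2 (norm_diskMoebius_lt_one ha (mem_ball_zero_iff.1 hz))
  have hder : ∀ {f : ℂ → ℂ}, DifferentiableOn ℂ f (ball 0 1) → ∀ {z}, z ∈ ball (0 : ℂ) 1 →
      HasDerivAt f (deriv f z) z := fun hf z hz =>
    (hf.differentiableAt (isOpen_ball.mem_nhds hz)).hasDerivAt
  have h0b : (0 : ℂ) ∈ ball (0 : ℂ) 1 := mem_ball_self one_pos
  set F : ℂ → ℂ := fun ζ => (φ (diskMoebius a ζ) - φ a) / ((1 - (‖a‖ : ℂ) ^ 2) * deriv φ a)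
    with hF
  have hF' : ∀ ζ ∈ ball (0 : ℂ) 1, HasDerivAt F
      (deriv φ (diskMoebius a ζ) / ((1 + conj a * ζ) ^ 2 * deriv φ a)) ζ := by
    intro ζ hζ
    have hζ1 := mem_ball_zero_iff.1 hζ
    have h1 := (((hder hd (hT hζ)).comp ζ (hasDerivAt_diskMoebius ha hζ1)).sub_const
      (φ a)).div_const ((1 - (‖a‖ : ℂ) ^ 2) * deriv φ a)
    refine h1.congr_deriv ?_
    have := one_add_conj_mul_ne_zero ha hζ1
    field_simp
  have hFS : F ∈ classS := by
    refine ⟨fun z hz => (hF' z hz).differentiableAt.differentiableWithinAt, ?_, ?_, ?_⟩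
    · intro z hz w hw h
      have h2 : (φ (diskMoebius a z) - φ a) / ((1 - (‖a‖ : ℂ) ^ 2) * deriv φ a) =
        (φ (diskMoebius a w) - φ a) / ((1 - (‖a‖ : ℂ) ^ 2) * deriv φ a) := h
      rw [div_left_inj' (mul_ne_zero hc hφa), sub_left_inj] at h2
      exact injOn_diskMoebius ha hz hw (hinj (hT hz) (hT hw) h2)
    · simp [hF, diskMoebius_zero]
    · rw [(hF' 0 h0b).deriv]
      simp [diskMoebius_zero, hφa]
  have h4 := norm_deriv_deriv_le_four hFS
  have he : deriv F =ᶠ[𝓝 0]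
      fun ζ => deriv φ (diskMoebius a ζ) / ((1 + conj a * ζ) ^ 2 * deriv φ a) := by
    filter_upwards [isOpen_ball.mem_nhds h0b] with ζ hζ using (hF' ζ hζ).deriv
  have hda : HasDerivAt (deriv φ) (deriv (deriv φ) a) (diskMoebius a 0) := by
    rw [diskMoebius_zero]
    exact hder (hd.deriv isOpen_ball) ha'
  have h5 := (hda.comp 0 (hasDerivAt_diskMoebius ha (ζ := 0) (by simp))).fun_div
    (((((hasDerivAt_id (0 : ℂ)).const_mul (conj a)).const_add 1).fun_pow 2).mul_const
      (deriv φ a)) (by simpa using hφa)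
  rw [he.deriv_eq] at h4
  refine le_trans (le_of_eq ?_) h4
  congr 1
  refine Eq.trans ?_ h5.deriv.symm
  simp [diskMoebius_zero]
  field_simp

open Metric Set in
-- Re(e φ''/φ') is the derivative of log |φ'| along the ray in direction e, so this is the
-- differential inequality that integrates to the distortion theorem.
theorem abs_re_sub_le_of_classS {φ : ℂ → ℂ} (hφ : φ ∈ classS)
    (hne : ∀ z ∈ ball (0 : ℂ) 1, deriv φ z ≠ 0) {e : ℂ} (he : ‖e‖ = 1) {t : ℝ} (ht : 0 ≤ t)
    (ht1 : t < 1) :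
    |(e * (deriv (deriv φ) (t * e) / deriv φ (t * e))).re * (1 - t ^ 2) - 2 * t| ≤ 4 := by
  have hn : ‖(t : ℂ) * e‖ = t := by rw [norm_mul, he, Complex.norm_of_nonneg ht, mul_one]
  have h := norm_preSchwarzian_sub_le hφ hne (a := t * e) (by rwa [hn])
  set P := deriv (deriv φ) (t * e) / deriv φ (t * e)
  rw [hn] at h
  have h2 : ‖e * ((1 - (t : ℂ) ^ 2) * P - 2 * conj (t * e))‖ ≤ 4 := by
    rwa [norm_mul, he, one_mul]
  refine le_trans (le_of_eq ?_) ((Complex.abs_re_le_norm _).trans h2)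
  congr 1
  have hee : e * conj e = 1 := by rw [Complex.mul_conj', he]; norm_num
  have h3 : e * ((1 - (t : ℂ) ^ 2) * P - 2 * conj (t * e)) =
      ((1 - t ^ 2 : ℝ) : ℂ) * (e * P) - ((2 * t : ℝ) : ℂ) := by
    rw [map_mul, Complex.conj_ofReal]
    push_cast
    linear_combination (-2 * t : ℂ) * hee
  rw [h3, Complex.sub_re, Complex.re_ofReal_mul, Complex.ofReal_re]
  ring

open Metric Set in
/-- The Koebe distortion theorem. -/
theorem distortion {φ : ℂ → ℂ} (hφ : φ ∈ classS)
    (hne : ∀ z ∈ ball (0 : ℂ) 1, deriv φ z ≠ 0) {z : ℂ} (hz : ‖z‖ < 1) :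
    (1 - ‖z‖) / (1 + ‖z‖) ^ 3 ≤ ‖deriv φ z‖ ∧ ‖deriv φ z‖ ≤ (1 + ‖z‖) / (1 - ‖z‖) ^ 3 := by
  obtain ⟨L, hLd, hL0, hLe, hL'⟩ := exists_log_of_ne_zero one_pos (hφ.1.deriv isOpen_ball) hne
  rw [hφ.2.2.2, Complex.log_one] at hL0
  obtain ⟨e, he, hze⟩ : ∃ e : ℂ, ‖e‖ = 1 ∧ z = ‖z‖ * e := by
    rcases eq_or_ne z 0 with rfl | h
    · exact ⟨1, by simp, by simp⟩
    · have : (‖z‖ : ℂ) ≠ 0 := by exact_mod_cast norm_ne_zero_iff.2 h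
      exact ⟨z / ‖z‖, by simp [h], by field_simp⟩
  have hmem : ∀ t : ℝ, 0 ≤ t → t < 1 → (t : ℂ) * e ∈ ball (0 : ℂ) 1 := by
    intro t h0 h1
    rw [mem_ball_zero_iff, norm_mul, he, Complex.norm_of_nonneg h0, mul_one]
    exact h1
  have hu : ∀ t : ℝ, 0 ≤ t → t < 1 → HasDerivAt (fun t : ℝ => (L (t * e)).re)
      (e * (deriv (deriv φ) (t * e) / deriv φ (t * e))).re t := by
    intro t h0 h1
    have h2 : HasDerivAt (fun t : ℝ => (t : ℂ) * e) (1 * e) t :=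
      Complex.ofRealCLM.hasDerivAt.mul_const e
    have h3 := (hL' _ (hmem t h0 h1)).comp t h2
    have h4 := Complex.reCLM.hasFDerivAt.comp_hasDerivAt t h3
    refine h4.congr_deriv ?_
    simp [mul_comm]
  have hlm : ∀ t : ℝ, t < 1 → HasDerivAt (fun t : ℝ => Real.log (1 - t)) (-1 / (1 - t)) t :=
    fun t h1 => ((hasDerivAt_id t).const_sub 1).log (by simp only [id]; linarith)
  have hlp : ∀ t : ℝ, 0 ≤ t → HasDerivAt (fun t : ℝ => Real.log (1 + t)) (1 / (1 + t)) t :=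
    fun t h1 => ((hasDerivAt_id t).const_add 1).log (by simp only [id]; linarith)
  set r := ‖z‖ with hr
  have hr0 : 0 ≤ r := norm_nonneg z
  have hz' : z ∈ ball (0 : ℂ) 1 := mem_ball_zero_iff.2 hz
  have hnorm : ‖deriv φ z‖ = Real.exp (L (r * e)).re := by
    rw [hLe z hz', Complex.norm_exp, ← hze]
  -- log((1 - t)/(1 + t)³) has derivative (2t - 4)/(1 - t²), the least slope that log |φ'| can have.
  -- Both sides vanish at 0. The upper bound uses the greatest slope (2t + 4)/(1 - t²) in the same
  -- way.
  have hlow : Real.log (1 - r) - 3 * Real.log (1 + r) ≤ (L (r * e)).re := by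
    have hm : MonotoneOn (fun t : ℝ => (L (t * e)).re - (Real.log (1 - t) - 3 * Real.log (1 + t)))
        (Ico 0 1) := by
      have hd : ∀ t ∈ Ico (0 : ℝ) 1, HasDerivAt
          (fun t : ℝ => (L (t * e)).re - (Real.log (1 - t) - 3 * Real.log (1 + t)))
          ((e * (deriv (deriv φ) (t * e) / deriv φ (t * e))).re -
            (-1 / (1 - t) - 3 * (1 / (1 + t)))) t := fun t ht =>
        (hu t ht.1 ht.2).sub ((hlm t ht.2).sub ((hlp t ht.1).const_mul 3))
      refine monotoneOn_of_deriv_nonneg (convex_Ico 0 1)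
        (fun t ht => (hd t ht).continuousAt.continuousWithinAt)
        (fun t ht => (hd t (interior_subset ht)).differentiableAt.differentiableWithinAt)
        fun t ht => ?_
      have ht' := interior_subset ht
      rw [(hd t ht').deriv]
      have hb := (abs_le.1 (abs_re_sub_le_of_classS hφ hne he ht'.1 ht'.2)).1
      have h1 : 0 < 1 - t := by linarith [ht'.2]
      have h2 : 0 < 1 + t := by linarith [ht'.1]
      set p := (e * (deriv (deriv φ) (t * e) / deriv φ (t * e))).re
      have : p - (-1 / (1 - t) - 3 * (1 / (1 + t))) =
          (p * (1 - t ^ 2) - 2 * t + 4) / ((1 - t) * (1 + t)) := by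
        field_simp
        ring
      rw [this]
      apply div_nonneg (by linarith) (by positivity)
    have := hm (left_mem_Ico.2 one_pos) ⟨hr0, hz⟩ hr0
    simp [hL0] at this
    linarith
  have hup : (L (r * e)).re ≤ Real.log (1 + r) - 3 * Real.log (1 - r) := by
    have hm : MonotoneOn (fun t : ℝ => (Real.log (1 + t) - 3 * Real.log (1 - t)) - (L (t * e)).re)
        (Ico 0 1) := by
      have hd : ∀ t ∈ Ico (0 : ℝ) 1, HasDerivAt
          (fun t : ℝ => (Real.log (1 + t) - 3 * Real.log (1 - t)) - (L (t * e)).re)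
          ((1 / (1 + t) - 3 * (-1 / (1 - t))) -
            (e * (deriv (deriv φ) (t * e) / deriv φ (t * e))).re) t := fun t ht =>
        ((hlp t ht.1).sub ((hlm t ht.2).const_mul 3)).sub (hu t ht.1 ht.2)
      refine monotoneOn_of_deriv_nonneg (convex_Ico 0 1)
        (fun t ht => (hd t ht).continuousAt.continuousWithinAt)
        (fun t ht => (hd t (interior_subset ht)).differentiableAt.differentiableWithinAt)
        fun t ht => ?_
      have ht' := interior_subset ht
      rw [(hd t ht').deriv]
      have hb := (abs_le.1 (abs_re_sub_le_of_classS hφ hne he ht'.1 ht'.2)).2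
      have h1 : 0 < 1 - t := by linarith [ht'.2]
      have h2 : 0 < 1 + t := by linarith [ht'.1]
      set p := (e * (deriv (deriv φ) (t * e) / deriv φ (t * e))).re
      have : 1 / (1 + t) - 3 * (-1 / (1 - t)) - p =
          (4 - (p * (1 - t ^ 2) - 2 * t)) / ((1 - t) * (1 + t)) := by
        field_simp
        ring
      rw [this]
      apply div_nonneg (by linarith) (by positivity)
    have := hm (left_mem_Ico.2 one_pos) ⟨hr0, hz⟩ hr0
    simp [hL0] at this
    linarith
  have h1 : 0 < 1 - r := by linarith
  have h2 : 0 < 1 + r := by linarith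
  rw [hnorm]
  constructor
  · rw [← Real.log_le_iff_le_exp (by positivity), Real.log_div (by positivity) (by positivity),
      Real.log_pow]
    exact_mod_cast hlow
  · rw [← Real.le_log_iff_exp_le (by positivity), Real.log_div (by positivity) (by positivity),
      Real.log_pow]
    exact_mod_cast hup

/-! ### Real differentials of harmonic maps and shear pairs -/

/-- The real-linear map `w ↦ a w + conj (b w)`. -/
noncomputable def harmonicFDeriv (a b : ℂ) : ℂ →L[ℝ] ℂ :=
  (ContinuousLinearMap.toSpanSingleton ℂ a).restrictScalars ℝ +
    (Complex.conjCLE : ℂ →L[ℝ] ℂ).comp ((ContinuousLinearMap.toSpanSingleton ℂ b).restrictScalars ℝ)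

theorem harmonicFDeriv_apply (a b w : ℂ) : harmonicFDeriv a b w = w * a + conj (w * b) := rfl

theorem hasFDerivAt_add_conj {h g : ℂ → ℂ} {a b z : ℂ} (hh : HasDerivAt h a z)
    (hg : HasDerivAt g b z) : HasFDerivAt (fun z => h z + conj (g z)) (harmonicFDeriv a b) z :=
  (hh.hasFDerivAt.restrictScalars ℝ).add
    ((Complex.conjCLE : ℂ →L[ℝ] ℂ).hasFDerivAt.comp z (hg.hasFDerivAt.restrictScalars ℝ))

/-- The analytic part, the co-analytic part and the angle of a member of `S_H⁰(S)`. -/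
structure IsShearPair (h g : ℂ → ℂ) (θ : ℝ) : Prop where
  hd : DifferentiableOn ℂ h (Metric.ball 0 1)
  gd : DifferentiableOn ℂ g (Metric.ball 0 1)
  deriv_h_zero : deriv h 0 = 1
  deriv_g_zero : deriv g 0 = 0
  norm_lt : ∀ z ∈ Metric.ball (0 : ℂ) 1, ‖deriv g z‖ < ‖deriv h z‖
  univ : (fun z => h z + Complex.exp (θ * Complex.I) * g z) ∈ classS

open Metric Filter Topology in
theorem IsDecomposition.hasFDerivAt {f h g : ℂ → ℂ} (hf : IsDecomposition f h g) {z : ℂ}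
    (hz : z ∈ ball (0 : ℂ) 1) : HasFDerivAt f (harmonicFDeriv (deriv h z) (deriv g z)) z := by
  have hn := isOpen_ball.mem_nhds hz
  refine (hasFDerivAt_add_conj (hf.analytic_part.differentiableAt hn).hasDerivAt
    (hf.coanalytic_part.differentiableAt hn).hasDerivAt).congr_of_eventuallyEq ?_
  filter_upwards [hn] with w hw using hf.eq_add_conj w hw

theorem harmonicFDeriv_injective {a b a' b' : ℂ}
    (h : harmonicFDeriv a b = harmonicFDeriv a' b') : a = a' ∧ b = b' := by
  have h1 := DFunLike.congr_fun h 1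
  have h2 := DFunLike.congr_fun h Complex.I
  simp only [harmonicFDeriv_apply, one_mul, map_mul, Complex.conj_I] at h1 h2
  have h3 : a + -conj b = a' + -conj b' := by
    have : Complex.I * (a + -conj b) = Complex.I * (a' + -conj b') := by linear_combination h2
    exact mul_left_cancel₀ Complex.I_ne_zero this
  have h4 : conj b = conj b' := by linear_combination (h1 - h3) / 2
  exact ⟨by linear_combination (h1 + h3) / 2, (starRingEnd ℂ).injective h4⟩

theorem wirtingerBar_eq {f : ℂ → ℂ} {a b z : ℂ} (hf : HasFDerivAt f (harmonicFDeriv a b) z) :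
    wirtingerBar f z = conj b := by
  rw [wirtingerBar, hf.fderiv, harmonicFDeriv_apply, harmonicFDeriv_apply]
  simp only [one_mul, map_mul, Complex.conj_I]
  linear_combination (a - conj b) / 2 * Complex.I_mul_I

open Metric in
-- The decomposition giving the Jacobian inequality and the one giving the univalent shear are a
-- priori different. Uniqueness of the real differential identifies their derivatives, so a single
-- pair has both properties.
theorem exists_isShearPair {f : ℂ → ℂ} (hf : f ∈ classSH0S) :
    ∃ h g θ, IsShearPair h g θ ∧ IsDecomposition f h g := by
  obtain ⟨⟨⟨h₁, g₁, hd₁, hj, -⟩, hw⟩, h, g, hd, θ, hθ⟩ := hf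
  have h0 : (0 : ℂ) ∈ ball (0 : ℂ) 1 := mem_ball_self one_pos
  refine ⟨h, g, θ, ⟨hd.analytic_part, hd.coanalytic_part, hd.deriv_h_zero, ?_, ?_, hθ⟩, hd⟩
  · rw [wirtingerBar_eq (hd.hasFDerivAt h0)] at hw
    simpa using hw
  · intro z hz
    obtain ⟨e1, e2⟩ := harmonicFDeriv_injective
      ((hd.hasFDerivAt hz).unique (hd₁.hasFDerivAt hz))
    rw [e1, e2]
    have := hj z hz
    exact lt_of_pow_lt_pow_left₀ 2 (norm_nonneg _) (by linarith)

/-! ### Velocity, acceleration and curvature of the image circles -/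

open Metric in
theorem hasDerivAt_circle {u v : ℂ → ℂ} (hu : DifferentiableOn ℂ u (ball 0 1))
    (hv : DifferentiableOn ℂ v (ball 0 1)) {z : ℂ} (hz : z ∈ ball (0 : ℂ) 1) (t : ℝ) :
    HasDerivAt (fun t : ℝ => u (z * Complex.exp (t * Complex.I)) +
        conj (v (z * Complex.exp (t * Complex.I))))
      (Complex.I * (z * Complex.exp (t * Complex.I)) * deriv u (z * Complex.exp (t * Complex.I)) +
        conj (Complex.I * (z * Complex.exp (t * Complex.I)) *
          deriv v (z * Complex.exp (t * Complex.I)))) t := by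
  have hm : z * Complex.exp (t * Complex.I) ∈ ball (0 : ℂ) 1 := by
    rw [mem_ball_zero_iff, norm_mul, Complex.norm_exp_ofReal_mul_I, mul_one]
    exact mem_ball_zero_iff.1 hz
  have hn := isOpen_ball.mem_nhds hm
  have h1 : HasDerivAt (fun t : ℝ => z * Complex.exp (t * Complex.I))
      (z * (Complex.exp (t * Complex.I) * (1 * Complex.I))) t :=
    ((Complex.ofRealCLM.hasDerivAt.mul_const Complex.I).cexp).const_mul z
  have h2 := (hasFDerivAt_add_conj (hu.differentiableAt hn).hasDerivAt
    (hv.differentiableAt hn).hasDerivAt).comp_hasDerivAt t h1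
  refine h2.congr_deriv ?_
  rw [harmonicFDeriv_apply]
  congr 1
  · ring
  · congr 1
    ring

/-- The velocity at `ζ` of the image of a circle under `h + conj g`. -/
noncomputable def velocity (h g : ℂ → ℂ) (ζ : ℂ) : ℂ :=
  Complex.I * ζ * deriv h ζ + conj (Complex.I * ζ * deriv g ζ)

/-- The acceleration at `ζ` of the image of a circle under `h + conj g`. -/
noncomputable def acceleration (h g : ℂ → ℂ) (ζ : ℂ) : ℂ :=
  -(ζ * deriv h ζ + ζ ^ 2 * deriv (deriv h) ζ) -
    conj (ζ * deriv g ζ + ζ ^ 2 * deriv (deriv g) ζ)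

open Metric in
theorem hasDerivAt_velocity {h g : ℂ → ℂ} (hh : DifferentiableOn ℂ h (ball 0 1))
    (hg : DifferentiableOn ℂ g (ball 0 1)) {z : ℂ} (hz : z ∈ ball (0 : ℂ) 1) (t : ℝ) :
    HasDerivAt (fun t : ℝ => velocity h g (z * Complex.exp (t * Complex.I)))
      (acceleration h g (z * Complex.exp (t * Complex.I))) t := by
  have hm : z * Complex.exp (t * Complex.I) ∈ ball (0 : ℂ) 1 := by
    rw [mem_ball_zero_iff, norm_mul, Complex.norm_exp_ofReal_mul_I, mul_one]
    exact mem_ball_zero_iff.1 hz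
  have hd : ∀ {u : ℂ → ℂ}, DifferentiableOn ℂ u (ball 0 1) →
      DifferentiableOn ℂ (fun ζ => Complex.I * ζ * deriv u ζ) (ball 0 1) := fun hu =>
    DifferentiableOn.mul (by fun_prop) (hu.deriv isOpen_ball)
  have hd' : ∀ {u : ℂ → ℂ}, DifferentiableOn ℂ u (ball 0 1) → ∀ {ζ}, ζ ∈ ball (0 : ℂ) 1 →
      deriv (fun ζ => Complex.I * ζ * deriv u ζ) ζ =
        Complex.I * deriv u ζ + Complex.I * ζ * deriv (deriv u) ζ := by
    intro u hu ζ hζ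
    have h1 := ((hu.deriv isOpen_ball).differentiableAt (isOpen_ball.mem_nhds hζ)).hasDerivAt
    have := (((hasDerivAt_id ζ).const_mul Complex.I).fun_mul h1).deriv
    simpa using this
  refine (hasDerivAt_circle (hd hh) (hd hg) hz t).congr_deriv ?_
  rw [hd' hh hm, hd' hg hm, acceleration]
  set ζ := z * Complex.exp (t * Complex.I)
  have e : ∀ u : ℂ → ℂ, Complex.I * ζ * (Complex.I * deriv u ζ +
      Complex.I * ζ * deriv (deriv u) ζ) = -(ζ * deriv u ζ + ζ ^ 2 * deriv (deriv u) ζ) := by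
    intro u
    linear_combination (ζ * deriv u ζ + ζ ^ 2 * deriv (deriv u) ζ) * Complex.I_mul_I
  rw [e, e, map_neg, ← sub_eq_add_neg]

/-- The cross product `x₁ y₂ - x₂ y₁` of two plane vectors. -/
noncomputable def cross (X Y : ℂ) : ℝ := X.re * Y.im - X.im * Y.re

open Metric in
-- The real-linear map w ↦ w + b conj w acts on velocity and acceleration alike, and multiplies
-- cross products by its determinant 1 - |b|².
theorem circleImageCurvature_eq {f f₀ h g : ℂ → ℂ} {b z : ℂ} (hd : IsDecomposition f₀ h g)
    (hf : ∀ z ∈ unitDisk, f z = f₀ z + b * conj (f₀ z)) (hz : z ∈ ball (0 : ℂ) 1) :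
    circleImageCurvature f z = (1 - ‖b‖ ^ 2) * cross (velocity h g z) (acceleration h g z) /
      ‖velocity h g z + b * conj (velocity h g z)‖ ^ 3 := by
  have hm : ∀ t : ℝ, z * Complex.exp (t * Complex.I) ∈ ball (0 : ℂ) 1 := fun t => by
    rw [mem_ball_zero_iff, norm_mul, Complex.norm_exp_ofReal_mul_I, mul_one]
    exact mem_ball_zero_iff.1 hz
  have haff : ∀ {γ : ℝ → ℂ} {γ' : ℂ} {t : ℝ}, HasDerivAt γ γ' t →
      HasDerivAt (fun t => γ t + b * conj (γ t)) (γ' + b * conj γ') t := fun {γ γ' t} hγ =>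
    hγ.add (((Complex.conjCLE : ℂ →L[ℝ] ℂ).hasFDerivAt.comp_hasDerivAt t hγ).const_mul b)
  have e0 : (fun t : ℝ => f (z * Complex.exp (t * Complex.I))) = fun t : ℝ =>
      (h (z * Complex.exp (t * Complex.I)) + conj (g (z * Complex.exp (t * Complex.I)))) +
      b * conj (h (z * Complex.exp (t * Complex.I)) +
        conj (g (z * Complex.exp (t * Complex.I)))) := by
    funext t
    rw [hf _ (hm t), hd.eq_add_conj _ (hm t)]
  have e1 : deriv (fun t : ℝ => f (z * Complex.exp (t * Complex.I))) = fun t : ℝ =>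
      velocity h g (z * Complex.exp (t * Complex.I)) +
        b * conj (velocity h g (z * Complex.exp (t * Complex.I))) := by
    funext t
    rw [e0]
    exact (haff (hasDerivAt_circle hd.analytic_part hd.coanalytic_part hz t)).deriv
  have e2 : deriv (deriv (fun t : ℝ => f (z * Complex.exp (t * Complex.I)))) 0 =
      acceleration h g z + b * conj (acceleration h g z) := by
    rw [e1]
    have := (haff (hasDerivAt_velocity hd.analytic_part hd.coanalytic_part hz 0)).deriv
    simpa using this
  rw [circleImageCurvature, signedCurvature, e2, e1]
  simp only [Complex.ofReal_zero, zero_mul, Complex.exp_zero, mul_one]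
  congr 1
  rw [← Complex.normSq_eq_norm_sq, Complex.normSq_apply]
  simp [cross]
  ring

/-- To be read with a = z h', c = e^{-iθ}, S the rotated dilatation, T = z S' and Q = z h''/h'. The
arguments of `cross` are then the velocity and the acceleration. -/
theorem cross_identity {a c S T Q : ℂ} (hc : ‖c‖ = 1) :
    cross (Complex.I * (a - conj (c * S * a)))
        (-(a * (1 + Q)) - conj (c * a * (T + S * (1 + Q)))) =
      ‖a‖ ^ 2 * (1 - ‖S‖ ^ 2) * (1 + Q).re + (c * a ^ 2 * T).re -
        ‖a‖ ^ 2 * (conj S * T).re := by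
  have hc2 : c.re * c.re + c.im * c.im = 1 := by
    rw [← Complex.normSq_apply, Complex.normSq_eq_norm_sq, hc, one_pow]
  rw [← Complex.normSq_eq_norm_sq, ← Complex.normSq_eq_norm_sq]
  simp only [Complex.normSq_apply, pow_two, cross]
  simp only [Complex.mul_re, Complex.mul_im, Complex.add_re, Complex.add_im, Complex.sub_re,
    Complex.sub_im, Complex.neg_re, Complex.neg_im, Complex.conj_re, Complex.conj_im,
    Complex.I_re, Complex.I_im, Complex.one_re, Complex.one_im]
  generalize c.re = c1 at *
  generalize c.im = c2 at *
  generalize a.re = a1 at *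
  generalize a.im = a2 at *
  generalize S.re = s1 at *
  generalize S.im = s2 at *
  generalize T.re = t1 at *
  generalize T.im = t2 at *
  generalize Q.re = q1 at *
  generalize Q.im = q2 at *
  linear_combination (-(a1 ^ 2 + a2 ^ 2) * ((s1 * t1 + s2 * t2) + (s1 ^ 2 + s2 ^ 2) * (1 + q1))) *
    hc2

/-- Replacing Q by P - T/(1 + S), with P = zφ''/φ', collapses every term containing T into Re T (c
a² - |a|² (1 + conj S)/(1 + S)). The last quotient is unimodular, whence the constant 2, uniform in
S. -/
theorem abs_cross_sub_le {a c S T P : ℂ} (hc : ‖c‖ = 1) (hS : 1 + S ≠ 0) :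
    |cross (Complex.I * (a - conj (c * S * a)))
        (-(a * (1 + (P - T / (1 + S)))) - conj (c * a * (T + S * (1 + (P - T / (1 + S)))))) -
      ‖a‖ ^ 2 * (1 - ‖S‖ ^ 2) * (1 + P.re)| ≤ 2 * ‖T‖ * ‖a‖ ^ 2 := by
  rw [cross_identity hc]
  have h1 : ‖a‖ ^ 2 * (1 - ‖S‖ ^ 2) * (1 + (P - T / (1 + S))).re + (c * a ^ 2 * T).re -
      ‖a‖ ^ 2 * (conj S * T).re - ‖a‖ ^ 2 * (1 - ‖S‖ ^ 2) * (1 + P.re) =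
      (T * (c * a ^ 2 - ((‖a‖ ^ 2 : ℝ) : ℂ) * ((1 + conj S) / (1 + S)))).re := by
    have h2 : T * (c * a ^ 2 - ((‖a‖ ^ 2 : ℝ) : ℂ) * ((1 + conj S) / (1 + S))) =
        c * a ^ 2 * T - ((‖a‖ ^ 2 : ℝ) : ℂ) * (conj S * T) -
          ((‖a‖ ^ 2 * (1 - ‖S‖ ^ 2) : ℝ) : ℂ) * (T / (1 + S)) := by
      have h3 : ((‖S‖ : ℂ)) ^ 2 = conj S * S := (Complex.conj_mul' S).symm
      push_cast
      rw [h3]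
      field_simp
      ring
    rw [h2, Complex.sub_re, Complex.sub_re, Complex.re_ofReal_mul, Complex.re_ofReal_mul]
    simp
    ring
  rw [h1]
  refine (Complex.abs_re_le_norm _).trans ?_
  rw [norm_mul, mul_comm 2, mul_assoc]
  gcongr
  refine (norm_sub_le _ _).trans ?_
  have h4 : ‖(1 + conj S) / (1 + S)‖ = 1 := by
    have : (1 + conj S) = conj (1 + S) := by simp
    rw [norm_div, this, RCLike.norm_conj, div_self (norm_ne_zero_iff.2 hS)]
  rw [norm_mul, norm_mul, hc, h4, norm_pow, Complex.norm_real]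
  simp
  linarith

theorem IsShearPair.deriv_ne_zero {h g : ℂ → ℂ} {θ : ℝ} (hs : IsShearPair h g θ) {z : ℂ}
    (hz : z ∈ Metric.ball (0 : ℂ) 1) : deriv h z ≠ 0 :=
  norm_pos_iff.1 ((norm_nonneg _).trans_lt (hs.norm_lt z hz))

/-! ### Dilatation estimates and the curvature bounds -/

/-- The rotated dilatation `e^{iθ} g' / h'`. -/
noncomputable def shearDilatation (h g : ℂ → ℂ) (θ : ℝ) (z : ℂ) : ℂ :=
  Complex.exp (θ * Complex.I) * (deriv g z / deriv h z)

section Dilatation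

variable {h g : ℂ → ℂ} {θ : ℝ}

open Metric Set

theorem IsShearPair.differentiableOn_dilatation (hs : IsShearPair h g θ) :
    DifferentiableOn ℂ (shearDilatation h g θ) (ball 0 1) :=
  ((hs.gd.deriv isOpen_ball).div (hs.hd.deriv isOpen_ball)
    fun _ hz => hs.deriv_ne_zero hz).const_mul _

theorem IsShearPair.mapsTo_dilatation (hs : IsShearPair h g θ) :
    MapsTo (shearDilatation h g θ) (ball 0 1) (ball 0 1) := fun z hz => by
  rw [mem_ball_zero_iff, shearDilatation, norm_mul, Complex.norm_exp_ofReal_mul_I, one_mul,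
    norm_div, div_lt_one (norm_pos_iff.2 (hs.deriv_ne_zero hz))]
  exact hs.norm_lt z hz

theorem IsShearPair.norm_dilatation_le (hs : IsShearPair h g θ) {z : ℂ}
    (hz : z ∈ ball (0 : ℂ) 1) : ‖shearDilatation h g θ z‖ ≤ ‖z‖ :=
  Complex.norm_le_norm_of_mapsTo_ball hs.differentiableOn_dilatation
    (fun _ hw => ball_subset_closedBall (hs.mapsTo_dilatation hw))
    (by simp [shearDilatation, hs.deriv_g_zero]) (mem_ball_zero_iff.1 hz)

theorem IsShearPair.one_add_dilatation_ne_zero (hs : IsShearPair h g θ) {z : ℂ}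
    (hz : z ∈ ball (0 : ℂ) 1) : 1 + shearDilatation h g θ z ≠ 0 := by
  intro h0
  have h1 := mem_ball_zero_iff.1 (hs.mapsTo_dilatation hz)
  rw [show shearDilatation h g θ z = -1 by linear_combination h0] at h1
  simp at h1

theorem IsShearPair.deriv_g_eq (hs : IsShearPair h g θ) {z : ℂ} (hz : z ∈ ball (0 : ℂ) 1) :
    deriv g z = Complex.exp (-(θ * Complex.I)) * shearDilatation h g θ z * deriv h z := by
  have := hs.deriv_ne_zero hz
  rw [shearDilatation, Complex.exp_neg]
  have h2 := Complex.exp_ne_zero (θ * Complex.I)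
  field_simp

theorem IsShearPair.deriv_shear_eq (hs : IsShearPair h g θ) {z : ℂ} (hz : z ∈ ball (0 : ℂ) 1) :
    deriv (fun z => h z + Complex.exp (θ * Complex.I) * g z) z =
      deriv h z * (1 + shearDilatation h g θ z) := by
  have hn := isOpen_ball.mem_nhds hz
  have := ((hs.hd.differentiableAt hn).hasDerivAt.add
    ((hs.gd.differentiableAt hn).hasDerivAt.const_mul (Complex.exp (θ * Complex.I)))).deriv
  refine Eq.trans this ?_
  have := hs.deriv_ne_zero hz
  rw [shearDilatation]
  field_simp

open Filter Topology in
theorem IsShearPair.deriv_deriv_g_eq (hs : IsShearPair h g θ) {z : ℂ}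
    (hz : z ∈ ball (0 : ℂ) 1) :
    deriv (deriv g) z = Complex.exp (-(θ * Complex.I)) *
      (deriv (shearDilatation h g θ) z * deriv h z +
        shearDilatation h g θ z * deriv (deriv h) z) := by
  have hn := isOpen_ball.mem_nhds hz
  have he : deriv g =ᶠ[𝓝 z] fun z =>
      Complex.exp (-(θ * Complex.I)) * (shearDilatation h g θ z * deriv h z) := by
    filter_upwards [hn] with w hw
    rw [hs.deriv_g_eq hw, mul_assoc]
  rw [he.deriv_eq]
  exact (((hs.differentiableOn_dilatation.differentiableAt hn).hasDerivAt.mul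
    ((hs.hd.deriv isOpen_ball).differentiableAt hn).hasDerivAt).const_mul _).deriv

open Filter Topology in
theorem IsShearPair.deriv_deriv_shear_eq (hs : IsShearPair h g θ) {z : ℂ}
    (hz : z ∈ ball (0 : ℂ) 1) :
    deriv (deriv (fun z => h z + Complex.exp (θ * Complex.I) * g z)) z =
      deriv (deriv h) z * (1 + shearDilatation h g θ z) +
        deriv h z * deriv (shearDilatation h g θ) z := by
  have hn := isOpen_ball.mem_nhds hz
  have he : deriv (fun z => h z + Complex.exp (θ * Complex.I) * g z) =ᶠ[𝓝 z] fun z =>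
      deriv h z * (1 + shearDilatation h g θ z) := by
    filter_upwards [hn] with w hw using hs.deriv_shear_eq hw
  rw [he.deriv_eq]
  exact (((hs.hd.deriv isOpen_ball).differentiableAt hn).hasDerivAt.mul
    ((hs.differentiableOn_dilatation.differentiableAt hn).hasDerivAt.const_add 1)).deriv

theorem IsShearPair.deriv_shear_ne_zero (hs : IsShearPair h g θ) {z : ℂ}
    (hz : z ∈ ball (0 : ℂ) 1) :
    deriv (fun z => h z + Complex.exp (θ * Complex.I) * g z) z ≠ 0 := by
  rw [hs.deriv_shear_eq hz]
  exact mul_ne_zero (hs.deriv_ne_zero hz) (hs.one_add_dilatation_ne_zero hz)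

theorem abs_re_preSchwarzian_le {φ : ℂ → ℂ} (hφ : φ ∈ classS)
    (hne : ∀ z ∈ ball (0 : ℂ) 1, deriv φ z ≠ 0) {z : ℂ} (hz : ‖z‖ < 1) :
    |(z * (deriv (deriv φ) z / deriv φ z)).re * (1 - ‖z‖ ^ 2) - 2 * ‖z‖ ^ 2| ≤ 4 * ‖z‖ := by
  have h := norm_preSchwarzian_sub_le hφ hne hz
  set P := deriv (deriv φ) z / deriv φ z
  have h2 : ‖z * ((1 - (‖z‖ : ℂ) ^ 2) * P - 2 * conj z)‖ ≤ 4 * ‖z‖ := by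
    rw [norm_mul, mul_comm]
    gcongr
  refine le_trans (le_of_eq ?_) ((Complex.abs_re_le_norm _).trans h2)
  congr 1
  have h3 : z * ((1 - (‖z‖ : ℂ) ^ 2) * P - 2 * conj z) =
      ((1 - ‖z‖ ^ 2 : ℝ) : ℂ) * (z * P) - ((2 * ‖z‖ ^ 2 : ℝ) : ℂ) := by
    push_cast
    linear_combination (-2 : ℂ) * Complex.mul_conj' z
  rw [h3, Complex.sub_re, Complex.re_ofReal_mul, Complex.ofReal_re]
  ring

/-- After multiplication by 1 - r², the main term is (1 + r² ± 4r) |zh'|² (1 - |S|²) at its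
extremes. Schwarz–Pick gives |S'| (1 - r²) ≤ 1 - |S|², so the error 2 r |S'| |zh'|² has the same
form with coefficient 2r. -/
theorem IsShearPair.cross_bounds (hs : IsShearPair h g θ) {z : ℂ} (hz : z ∈ ball (0 : ℂ) 1) :
    (‖z‖ ^ 2 - 6 * ‖z‖ + 1) / (1 - ‖z‖ ^ 2) *
        (‖z * deriv h z‖ ^ 2 * (1 - ‖shearDilatation h g θ z‖ ^ 2)) ≤
      cross (velocity h g z) (acceleration h g z) ∧
    cross (velocity h g z) (acceleration h g z) ≤
      (‖z‖ ^ 2 + 6 * ‖z‖ + 1) / (1 - ‖z‖ ^ 2) *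
        (‖z * deriv h z‖ ^ 2 * (1 - ‖shearDilatation h g θ z‖ ^ 2)) := by
  have hz1 : ‖z‖ < 1 := mem_ball_zero_iff.1 hz
  have hh := hs.deriv_ne_zero hz
  have hS1 := hs.one_add_dilatation_ne_zero hz
  have hp := abs_re_preSchwarzian_le hs.univ (fun w hw => hs.deriv_shear_ne_zero hw) hz1
  have hsp := norm_deriv_mul_le_of_mapsTo_unit_ball hs.differentiableOn_dilatation
    hs.mapsTo_dilatation hz
  have hS := mem_ball_zero_iff.1 (hs.mapsTo_dilatation hz)
  have hc : ‖Complex.exp (-(θ * Complex.I))‖ = 1 := by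
    rw [← neg_mul, ← Complex.ofReal_neg, Complex.norm_exp_ofReal_mul_I]
  have key := abs_cross_sub_le (a := z * deriv h z) (c := Complex.exp (-(θ * Complex.I)))
    (S := shearDilatation h g θ z) (T := z * deriv (shearDilatation h g θ) z)
    (P := z * (deriv (deriv (fun z => h z + Complex.exp (θ * Complex.I) * g z)) z /
      deriv (fun z => h z + Complex.exp (θ * Complex.I) * g z) z)) hc hS1
  -- Logarithmic differentiation of φ' = h' (1 + S).
  have hP : z * (deriv (deriv (fun z => h z + Complex.exp (θ * Complex.I) * g z)) z /
      deriv (fun z => h z + Complex.exp (θ * Complex.I) * g z) z) -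
      z * deriv (shearDilatation h g θ) z / (1 + shearDilatation h g θ z) =
      z * deriv (deriv h) z / deriv h z := by
    rw [hs.deriv_deriv_shear_eq hz, hs.deriv_shear_eq hz]
    field_simp
    ring
  have hv : velocity h g z = Complex.I * (z * deriv h z -
      conj (Complex.exp (-(θ * Complex.I)) * shearDilatation h g θ z * (z * deriv h z))) := by
    rw [velocity, hs.deriv_g_eq hz]
    simp only [map_mul, Complex.conj_I]
    ring
  have ha : acceleration h g z = -(z * deriv h z * (1 + z * deriv (deriv h) z / deriv h z)) -
      conj (Complex.exp (-(θ * Complex.I)) * (z * deriv h z) *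
        (z * deriv (shearDilatation h g θ) z + shearDilatation h g θ z *
          (1 + z * deriv (deriv h) z / deriv h z))) := by
    rw [acceleration, hs.deriv_deriv_g_eq hz, hs.deriv_g_eq hz]
    congr 2
    · field_simp
    · field_simp
      ring
  rw [hP, ← hv, ← ha, norm_mul z (deriv (shearDilatation h g θ) z)] at key
  set p := (z * (deriv (deriv (fun z => h z + Complex.exp (θ * Complex.I) * g z)) z /
      deriv (fun z => h z + Complex.exp (θ * Complex.I) * g z) z)).re
  set X := cross (velocity h g z) (acceleration h g z)
  set r := ‖z‖
  set M := ‖z * deriv h z‖ ^ 2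
  set D := ‖deriv (shearDilatation h g θ) z‖
  set s := ‖shearDilatation h g θ z‖
  have hr0 : 0 ≤ r := norm_nonneg _
  have hM : 0 ≤ M := sq_nonneg _
  have hs0 : 0 ≤ s := norm_nonneg _
  have hr2 : 0 < 1 - r ^ 2 := by nlinarith
  have hs2 : 0 < 1 - s ^ 2 := by nlinarith
  obtain ⟨k1, k2⟩ := abs_le.1 key
  obtain ⟨p1, p2⟩ := abs_le.1 hp
  have hN : 0 ≤ M * (1 - s ^ 2) := by positivity
  have d1 : r * M * (D * (1 - r ^ 2)) ≤ r * M * (1 - s ^ 2) := by gcongr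
  have k1' := mul_le_mul_of_nonneg_right k1 hr2.le
  have k2' := mul_le_mul_of_nonneg_right k2 hr2.le
  have p1' := mul_le_mul_of_nonneg_left p1 hN
  have p2' := mul_le_mul_of_nonneg_left p2 hN
  rw [div_mul_eq_mul_div, div_le_iff₀ hr2, div_mul_eq_mul_div, le_div_iff₀ hr2]
  constructor <;> nlinarith

theorem IsShearPair.norm_velocity_bounds (hs : IsShearPair h g θ) {z : ℂ}
    (hz : z ∈ ball (0 : ℂ) 1) :
    ‖z * deriv h z‖ * (1 - ‖shearDilatation h g θ z‖) ≤ ‖velocity h g z‖ ∧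
      ‖velocity h g z‖ ≤ ‖z * deriv h z‖ * (1 + ‖shearDilatation h g θ z‖) := by
  have hc : ‖Complex.exp (-(θ * Complex.I))‖ = 1 := by
    rw [← neg_mul, ← Complex.ofReal_neg, Complex.norm_exp_ofReal_mul_I]
  have e1 : ‖Complex.I * z * deriv h z‖ = ‖z * deriv h z‖ := by simp
  have e2 : ‖conj (Complex.I * z * deriv g z)‖ =
      ‖z * deriv h z‖ * ‖shearDilatation h g θ z‖ := by
    rw [hs.deriv_g_eq hz, RCLike.norm_conj]
    simp [hc]
    ring
  constructor
  · have := norm_sub_le_norm_add (Complex.I * z * deriv h z) (conj (Complex.I * z * deriv g z))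
    rw [e1, e2] at this
    rw [velocity]
    linarith
  · have := norm_add_le (Complex.I * z * deriv h z) (conj (Complex.I * z * deriv g z))
    rw [e1, e2] at this
    rw [velocity]
    linarith

/-- Here β = |b|, s = |S|, p = |φ'|, M = |zh'| and N is the speed. Inserting the least N and then
the least M leaves ((1 + s)/(1 - s))², which increases in s and is therefore largest at s = r. -/
theorem curvature_factor_le {β r s p M N : ℝ} (hβ0 : 0 ≤ β) (hβ : β < 1) (hr0 : 0 < r)
    (hr : r < 1) (hs0 : 0 ≤ s) (hsr : s ≤ r) (hp : (1 - r) / (1 + r) ^ 3 ≤ p)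
    (hM : r * p ≤ M * (1 + s)) (hN : (1 - β) * (M * (1 - s)) ≤ N) :
    (1 - β ^ 2) * (M ^ 2 * (1 - s ^ 2)) / N ^ 3 ≤
      (1 + β) / (1 - β) ^ 2 * ((1 + r) / (1 - r)) ^ 4 * ((1 - r ^ 2) / r) := by
  have h1β : 0 < 1 - β := by linarith
  have h1r : 0 < 1 - r := by linarith
  have h1s : 0 < 1 - s := by linarith
  have hp0 : 0 < p := lt_of_lt_of_le (by positivity) hp
  have hM1 : r * ((1 - r) / (1 + r) ^ 3) / (1 + s) ≤ M := by
    rw [div_le_iff₀ (by positivity)]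
    exact le_trans (by gcongr) hM
  have hM0 : 0 < M := lt_of_lt_of_le (by positivity) hM1
  have hs2 : 0 < 1 - s ^ 2 := by nlinarith
  have hβ2 : 0 < 1 - β ^ 2 := by nlinarith
  calc (1 - β ^ 2) * (M ^ 2 * (1 - s ^ 2)) / N ^ 3
      ≤ (1 - β ^ 2) * (M ^ 2 * (1 - s ^ 2)) / ((1 - β) * (M * (1 - s))) ^ 3 := by gcongr
    _ = (1 + β) / (1 - β) ^ 2 * ((1 + s) / (1 - s) ^ 2) / M := by field_simp; ring
    _ ≤ (1 + β) / (1 - β) ^ 2 * ((1 + s) / (1 - s) ^ 2) /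
        (r * ((1 - r) / (1 + r) ^ 3) / (1 + s)) := by gcongr
    _ = (1 + β) / (1 - β) ^ 2 * ((1 + s) ^ 2 / (1 - s) ^ 2) *
        ((1 + r) ^ 3 / (r * (1 - r))) := by field_simp
    _ ≤ (1 + β) / (1 - β) ^ 2 * ((1 + r) ^ 2 / (1 - r) ^ 2) *
        ((1 + r) ^ 3 / (r * (1 - r))) := by gcongr
    _ = _ := by field_simp; ring

theorem le_curvature_factor {β r s p M N : ℝ} (hβ0 : 0 ≤ β) (hβ : β < 1) (hr0 : 0 < r)
    (hr : r < 1) (hs0 : 0 ≤ s) (hsr : s ≤ r) (hp : p ≤ (1 + r) / (1 - r) ^ 3)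
    (hM0 : 0 < M) (hM : M * (1 - s) ≤ r * p) (hN0 : 0 < N) (hN : N ≤ (1 + β) * (M * (1 + s))) :
    (1 - β) / (1 + β) ^ 2 * ((1 - r) / (1 + r)) ^ 4 * ((1 - r ^ 2) / r) ≤
      (1 - β ^ 2) * (M ^ 2 * (1 - s ^ 2)) / N ^ 3 := by
  have h1β : 0 < 1 - β := by linarith
  have h1r : 0 < 1 - r := by linarith
  have h1s : 0 < 1 - s := by linarith
  have hM1 : M ≤ r * ((1 + r) / (1 - r) ^ 3) / (1 - s) := by
    rw [le_div_iff₀ (by positivity)]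
    exact hM.trans (by gcongr)
  have hs2 : 0 < 1 - s ^ 2 := by nlinarith
  have hβ2 : 0 < 1 - β ^ 2 := by nlinarith
  calc (1 - β) / (1 + β) ^ 2 * ((1 - r) / (1 + r)) ^ 4 * ((1 - r ^ 2) / r)
      = (1 - β) / (1 + β) ^ 2 * ((1 - r) ^ 2 / (1 + r) ^ 2) *
        ((1 - r) ^ 3 / (r * (1 + r))) := by field_simp; ring
    _ ≤ (1 - β) / (1 + β) ^ 2 * ((1 - s) ^ 2 / (1 + s) ^ 2) *
        ((1 - r) ^ 3 / (r * (1 + r))) := by gcongr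
    _ = (1 - β) / (1 + β) ^ 2 * ((1 - s) / (1 + s) ^ 2) /
        (r * ((1 + r) / (1 - r) ^ 3) / (1 - s)) := by field_simp
    _ ≤ (1 - β) / (1 + β) ^ 2 * ((1 - s) / (1 + s) ^ 2) / M := by gcongr
    _ = (1 - β ^ 2) * (M ^ 2 * (1 - s ^ 2)) / ((1 + β) * (M * (1 + s))) ^ 3 := by
        field_simp; ring
    _ ≤ _ := by gcongr

theorem sq_sub_six_mul_add_one_nonneg_iff {r : ℝ} (hr : r < 1) :
    0 ≤ r ^ 2 - 6 * r + 1 ↔ r ≤ 3 - 2 * Real.sqrt 2 := by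
  have h2 := Real.sq_sqrt (show (0 : ℝ) ≤ 2 by norm_num)
  have h0 := Real.sqrt_nonneg 2
  constructor
  · intro h
    by_contra! hc
    nlinarith
  · intro h
    nlinarith

theorem curvature_bounds {f : ℂ → ℂ} {b : ℂ} {f₀ : ℂ → ℂ} (hs : IsShearPair h g θ)
    (hd : IsDecomposition f₀ h g) (hb : ‖b‖ < 1)
    (hf : ∀ z ∈ unitDisk, f z = f₀ z + b * conj (f₀ z)) {z : ℂ} {r : ℝ} (hzr : r = ‖z‖)
    (hr0 : 0 < r) (hr : r < 1) :
    circleImageCurvature f z ≤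
        (1 + ‖b‖) / (1 - ‖b‖) ^ 2 * ((1 + r) / (1 - r)) ^ 4 * ((r ^ 2 + 6 * r + 1) / r) ∧
      (r ≤ 3 - 2 * Real.sqrt 2 →
        (1 - ‖b‖) / (1 + ‖b‖) ^ 2 * ((1 - r) / (1 + r)) ^ 4 * ((r ^ 2 - 6 * r + 1) / r) ≤
          circleImageCurvature f z) ∧
      (3 - 2 * Real.sqrt 2 < r →
        (1 + ‖b‖) / (1 - ‖b‖) ^ 2 * ((1 + r) / (1 - r)) ^ 4 * ((r ^ 2 - 6 * r + 1) / r) ≤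
          circleImageCurvature f z) := by
  have hz : z ∈ ball (0 : ℂ) 1 := by rw [mem_ball_zero_iff, ← hzr]; exact hr
  have hz0 : z ≠ 0 := norm_pos_iff.1 (hzr ▸ hr0)
  rw [circleImageCurvature_eq hd hf hz]
  obtain ⟨c1, c2⟩ := hs.cross_bounds hz
  obtain ⟨v1, v2⟩ := hs.norm_velocity_bounds hz
  obtain ⟨p1, p2⟩ := distortion hs.univ (fun w hw => hs.deriv_shear_ne_zero hw)
    (mem_ball_zero_iff.1 hz)
  rw [hs.deriv_shear_eq hz] at p1 p2
  have hsr := hs.norm_dilatation_le hz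
  have hS := mem_ball_zero_iff.1 (hs.mapsTo_dilatation hz)
  have hM0 : 0 < ‖z * deriv h z‖ := norm_pos_iff.2 (mul_ne_zero hz0 (hs.deriv_ne_zero hz))
  have hb0 := norm_nonneg b
  have hs0 := norm_nonneg (shearDilatation h g θ z)
  have n1 : (1 - ‖b‖) * ‖velocity h g z‖ ≤ ‖velocity h g z + b * conj (velocity h g z)‖ := by
    have := norm_sub_le_norm_add (velocity h g z) (b * conj (velocity h g z))
    rw [norm_mul, RCLike.norm_conj] at this
    linarith
  have n2 : ‖velocity h g z + b * conj (velocity h g z)‖ ≤ (1 + ‖b‖) * ‖velocity h g z‖ := by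
    have := norm_add_le (velocity h g z) (b * conj (velocity h g z))
    rw [norm_mul, RCLike.norm_conj] at this
    linarith
  have m1 : r * ‖deriv h z * (1 + shearDilatation h g θ z)‖ ≤
      ‖z * deriv h z‖ * (1 + ‖shearDilatation h g θ z‖) := by
    rw [norm_mul, norm_mul, ← hzr, ← mul_assoc]
    gcongr
    exact (norm_add_le _ _).trans_eq (by simp)
  have m2 : ‖z * deriv h z‖ * (1 - ‖shearDilatation h g θ z‖) ≤
      r * ‖deriv h z * (1 + shearDilatation h g θ z)‖ := by
    rw [norm_mul, norm_mul, ← hzr, ← mul_assoc]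
    gcongr
    have := norm_sub_le_norm_add 1 (shearDilatation h g θ z)
    simpa using this
  rw [← hzr] at c1 c2 p1 p2 hsr
  have hV0 : 0 < ‖velocity h g z‖ := lt_of_lt_of_le (mul_pos hM0 (by linarith)) v1
  have N1 : (1 - ‖b‖) * (‖z * deriv h z‖ * (1 - ‖shearDilatation h g θ z‖)) ≤
      ‖velocity h g z + b * conj (velocity h g z)‖ :=
    le_trans (mul_le_mul_of_nonneg_left v1 (by linarith)) n1
  have N2 : ‖velocity h g z + b * conj (velocity h g z)‖ ≤
      (1 + ‖b‖) * (‖z * deriv h z‖ * (1 + ‖shearDilatation h g θ z‖)) :=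
    n2.trans (mul_le_mul_of_nonneg_left v2 (by linarith))
  have N0 : 0 < ‖velocity h g z + b * conj (velocity h g z)‖ :=
    lt_of_lt_of_le (mul_pos (by linarith) hV0) n1
  have gU := curvature_factor_le hb0 hb hr0 hr hs0 hsr p1 m1 N1
  have gL := le_curvature_factor hb0 hb hr0 hr hs0 hsr p2 hM0 m2 N0 N2
  set X := cross (velocity h g z) (acceleration h g z)
  set N := ‖velocity h g z + b * conj (velocity h g z)‖
  set B := ‖z * deriv h z‖ ^ 2 * (1 - ‖shearDilatation h g θ z‖ ^ 2)
  have hβ2 : 0 ≤ 1 - ‖b‖ ^ 2 := by nlinarith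
  have hr2 : 0 < 1 - r ^ 2 := by nlinarith
  have kU : (1 - ‖b‖ ^ 2) * X / N ^ 3 ≤
      (r ^ 2 + 6 * r + 1) / (1 - r ^ 2) * ((1 - ‖b‖ ^ 2) * B / N ^ 3) := by
    rw [show (r ^ 2 + 6 * r + 1) / (1 - r ^ 2) * ((1 - ‖b‖ ^ 2) * B / N ^ 3) =
      (1 - ‖b‖ ^ 2) * ((r ^ 2 + 6 * r + 1) / (1 - r ^ 2) * B) / N ^ 3 by ring]
    gcongr
  have kL : (r ^ 2 - 6 * r + 1) / (1 - r ^ 2) * ((1 - ‖b‖ ^ 2) * B / N ^ 3) ≤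
      (1 - ‖b‖ ^ 2) * X / N ^ 3 := by
    rw [show (r ^ 2 - 6 * r + 1) / (1 - r ^ 2) * ((1 - ‖b‖ ^ 2) * B / N ^ 3) =
      (1 - ‖b‖ ^ 2) * ((r ^ 2 - 6 * r + 1) / (1 - r ^ 2) * B) / N ^ 3 by ring]
    gcongr
  -- Separates the quadratic supplied by the cross product from the positive factor bounded by `gU`
  -- and `gL`.
  have hfac : ∀ E q : ℝ, E * (q / r) = q / (1 - r ^ 2) * (E * ((1 - r ^ 2) / r)) := by
    intro E q
    field_simp
  refine ⟨?_, fun hρ => ?_, fun hρ => ?_⟩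
  · rw [hfac]
    exact kU.trans (mul_le_mul_of_nonneg_left gU (by positivity))
  · rw [hfac]
    have := (sq_sub_six_mul_add_one_nonneg_iff hr).2 hρ
    exact (mul_le_mul_of_nonneg_left gL (by positivity)).trans kL
  · rw [hfac]
    have h6 : r ^ 2 - 6 * r + 1 ≤ 0 := by
      by_contra! h6
      exact absurd ((sq_sub_six_mul_add_one_nonneg_iff hr).1 h6.le) (not_le.2 hρ)
    -- Beyond ρ the quadratic is nonpositive, so the lower curvature bound needs the upper bound on
    -- the positive factor.
    exact (mul_le_mul_of_nonpos_left gU (div_nonpos_of_nonpos_of_nonneg h6 hr2.le)).trans kL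

end Dilatation

/-! ### Convexity from a monotone tangent angle -/

open Set Topology Filter in
-- The signed height S over the tangent at t₀ has derivative ρ sin(ψ - ψ(t₀)). Over one period the
-- angle difference goes from 0 to 2π, so S rises from 0 until the difference reaches π and then
-- falls back to 0.
theorem im_mul_sub_nonneg_of_monotone_angle {γ : ℝ → ℂ} {ρ ψ : ℝ → ℝ} (hρ : ∀ t, 0 ≤ ρ t)
    (hγ : ∀ t, HasDerivAt γ (ρ t * Complex.exp (ψ t * Complex.I)) t) (hψ : Monotone ψ)
    (hψp : ∀ t, ψ (t + 2 * Real.pi) = ψ t + 2 * Real.pi)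
    (hγp : Function.Periodic γ (2 * Real.pi)) (t₀ t : ℝ) :
    0 ≤ (Complex.exp (-(ψ t₀ * Complex.I)) * (γ t - γ t₀)).im := by
  set S : ℝ → ℝ := fun t => (Complex.exp (-(ψ t₀ * Complex.I)) * (γ t - γ t₀)).im with hS
  have hSd : ∀ t, HasDerivAt S (ρ t * Real.sin (ψ t - ψ t₀)) t := by
    intro t
    have h1 := Complex.imCLM.hasFDerivAt.comp_hasDerivAt t
      (((hγ t).sub_const (γ t₀)).const_mul (Complex.exp (-(ψ t₀ * Complex.I))))
    refine h1.congr_deriv ?_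
    have h2 : Complex.exp (-(ψ t₀ * Complex.I)) * (ρ t * Complex.exp (ψ t * Complex.I)) =
        ρ t * Complex.exp (((ψ t - ψ t₀ : ℝ) : ℂ) * Complex.I) := by
      rw [mul_left_comm, ← Complex.exp_add]
      congr 2
      push_cast
      ring
    rw [Complex.imCLM_apply, h2, Complex.im_ofReal_mul, Complex.exp_ofReal_mul_I_im]
  have hSc : Continuous S := continuous_iff_continuousAt.2 fun t => (hSd t).continuousAt
  have hS0 : S t₀ = 0 := by simp [hS]
  have hS1 : S (t₀ + 2 * Real.pi) = 0 := by simp [hS, hγp t₀]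
  obtain ⟨u, hu, hut⟩ := hγp.exists_mem_Ico Real.two_pi_pos t t₀
  have hSt : S t = S u := by simp only [hS, hut]
  change 0 ≤ S t
  rw [hSt]
  have hd0 : ∀ s ∈ Icc t₀ (t₀ + 2 * Real.pi), 0 ≤ ψ s - ψ t₀ ∧ ψ s - ψ t₀ ≤ 2 * Real.pi := by
    intro s hs
    have h1 := hψ hs.1
    have h2 := hψ hs.2
    rw [hψp] at h2
    constructor <;> linarith
  rcases le_total (ψ u - ψ t₀) Real.pi with hle | hle
  · have hm : MonotoneOn S (Icc t₀ u) := by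
      refine monotoneOn_of_deriv_nonneg (convex_Icc _ _) hSc.continuousOn
        (fun s _ => (hSd s).differentiableAt.differentiableWithinAt) fun s hs => ?_
      have hs' := interior_subset hs
      rw [(hSd s).deriv]
      refine mul_nonneg (hρ s) (Real.sin_nonneg_of_nonneg_of_le_pi ?_ ?_)
      · linarith [hψ hs'.1]
      · linarith [hψ hs'.2]
    rw [← hS0]
    exact hm (left_mem_Icc.2 hu.1) (right_mem_Icc.2 hu.1) hu.1
  · have hm : AntitoneOn S (Icc u (t₀ + 2 * Real.pi)) := by
      refine antitoneOn_of_deriv_nonpos (convex_Icc _ _) hSc.continuousOn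
        (fun s _ => (hSd s).differentiableAt.differentiableWithinAt) fun s hs => ?_
      have hs' := interior_subset hs
      rw [(hSd s).deriv]
      refine mul_nonpos_of_nonneg_of_nonpos (hρ s) ?_
      have h1 := (hd0 s ⟨hu.1.trans hs'.1, hs'.2⟩).2
      have h2 := hψ hs'.1
      rw [← Real.sin_sub_two_pi]
      exact Real.sin_nonpos_of_nonpos_of_neg_pi_le (by linarith) (by linarith)
    rw [← hS1]
    exact hm (left_mem_Icc.2 hu.2.le) (right_mem_Icc.2 hu.2.le) hu.2.le

open Set Topology Filter in
-- Openness makes the support inequalities strict on U. A frontier point on a segment with endpoints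
-- in U would have a positive weighted sum of heights equal to 0, so the segment misses the
-- frontier, and by connectedness it stays in U.
theorem convex_of_forall_frontier_support {U : Set ℂ} (hU : IsOpen U)
    (h : ∀ p ∈ frontier U, ∃ c : ℂ, c ≠ 0 ∧ ∀ w ∈ U, 0 ≤ (c * (w - p)).im) : Convex ℝ U := by
  have hpos : ∀ p ∈ frontier U, ∃ c : ℂ, ∀ w ∈ U, 0 < (c * (w - p)).im := by
    intro p hp
    obtain ⟨c, hc, hcU⟩ := h p hp
    refine ⟨c, fun w hw => (hcU w hw).lt_of_ne fun h0 => ?_⟩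
    -- This displacement lowers Im(c(w - p)) by s |c|², violating the support inequality if it were
    -- an equality at w.
    have hcont : Continuous fun s : ℝ => w - s * (Complex.I * conj c) := by fun_prop
    have hev : ∀ᶠ s : ℝ in 𝓝[>] 0, w - s * (Complex.I * conj c) ∈ U := by
      refine (hcont.tendsto 0).eventually_mem ?_ |>.filter_mono nhdsWithin_le_nhds
      simpa using hU.mem_nhds hw
    obtain ⟨s, hsU, hs0⟩ := (hev.and self_mem_nhdsWithin).exists
    have h1 := hcU _ hsU
    have h2 : c * (w - s * (Complex.I * conj c) - p) =
        c * (w - p) - ((s * ‖c‖ ^ 2 : ℝ) : ℂ) * Complex.I := by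
      push_cast
      linear_combination (-(s : ℂ) * Complex.I) * Complex.mul_conj' c
    rw [h2, Complex.sub_im, ← h0, Complex.im_ofReal_mul, Complex.I_im] at h1
    have : 0 < s * ‖c‖ ^ 2 := mul_pos hs0 (pow_pos (norm_pos_iff.2 hc) 2)
    linarith
  rw [convex_iff_segment_subset]
  intro x hx y hy
  have hdisj : Disjoint (segment ℝ x y) (frontier U) := by
    rw [Set.disjoint_left]
    rintro p ⟨a, b, ha, hb, hab, rfl⟩ hp
    obtain ⟨c, hc⟩ := hpos _ hp
    set p := a • x + b • y
    have hx' := hc x hx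
    have hy' := hc y hy
    have hsum : a * (c * (x - p)).im + b * (c * (y - p)).im = 0 := by
      rw [← Complex.im_ofReal_mul, ← Complex.im_ofReal_mul, ← Complex.add_im]
      have : (a : ℂ) * (c * (x - p)) + b * (c * (y - p)) = 0 := by
        have hp' : p = a * x + b * y := by simp [p]
        have hab' : (a : ℂ) + b = 1 := by exact_mod_cast hab
        linear_combination (-c * p) * hab' - c * hp'
      rw [this, Complex.zero_im]
    rcases ha.eq_or_lt with rfl | ha
    · rw [zero_add] at hab
      rw [hab] at hsum
      linarith
    · have := mul_pos ha hx'
      have := mul_nonneg hb hy'.le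
      linarith
  refine (convex_segment x y).isPreconnected.subset_left_of_subset_union hU
    (v := (closure U)ᶜ) isClosed_closure.isOpen_compl ?_ ?_ ⟨x, left_mem_segment ℝ x y, hx⟩
  · rw [Set.disjoint_left]
    exact fun w hw hw' => hw' (subset_closure hw)
  · intro w hw
    by_cases hwU : w ∈ U
    · exact Or.inl hwU
    · refine Or.inr fun hwc => Set.disjoint_left.1 hdisj hw ?_
      rw [hU.frontier_eq]
      exact ⟨hwc, hwU⟩

open Metric Set in
-- The maximum principle for exp(iF), whose modulus is exp(-Im F).
theorem le_im_on_ball_of_le_im_on_sphere {F : ℂ → ℂ} {r m : ℝ}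
    (hF : DifferentiableOn ℂ F (ball 0 1)) (hr0 : r ≠ 0) (hr : r < 1)
    (hm : ∀ z ∈ sphere (0 : ℂ) r, m ≤ (F z).im) {z : ℂ} (hz : z ∈ ball (0 : ℂ) r) :
    m ≤ (F z).im := by
  have hd : DiffContOnCl ℂ (fun z => Complex.exp (Complex.I * F z)) (ball 0 r) := by
    apply DifferentiableOn.diffContOnCl
    rw [closure_ball _ hr0]
    exact ((hF.mono (closedBall_subset_ball hr)).const_mul _).cexp
  have h := Complex.norm_le_of_forall_mem_frontier_norm_le isBounded_ball hd
    (C := Real.exp (-m)) (fun w hw => by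
      rw [frontier_ball _ hr0] at hw
      rw [Complex.norm_exp, Real.exp_le_exp]
      simpa using hm w hw) (subset_closure hz)
  rw [Complex.norm_exp, Real.exp_le_exp] at h
  simpa using h

section Convexity

variable {h g : ℂ → ℂ} {θ : ℝ}

open Metric Set Filter Topology

/-- The quotient is 1 plus a number of modulus |g'/h'| < 1, so its principal logarithm is smooth
along circles and contributes no winding. -/
theorem IsShearPair.velocity_eq (hs : IsShearPair h g θ) {z : ℂ} (hz : z ∈ ball (0 : ℂ) 1)
    (hz0 : z ≠ 0) :
    velocity h g z / (Complex.I * z * deriv h z) ∈ Complex.slitPlane := by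
  have hne : Complex.I * z * deriv h z ≠ 0 :=
    mul_ne_zero (mul_ne_zero Complex.I_ne_zero hz0) (hs.deriv_ne_zero hz)
  rw [velocity, add_div, div_self hne]
  apply Complex.mem_slitPlane_of_norm_lt_one
  rw [norm_div, RCLike.norm_conj, div_lt_one (norm_pos_iff.2 hne), norm_mul, norm_mul]
  rw [norm_mul (Complex.I * z), norm_mul]
  exact mul_lt_mul_of_pos_left (hs.norm_lt z hz) (by simpa using hz0)

/-- Along a circle of radius at most `3 - 2 √2` the direction of the velocity is an increasing
function which grows by `2 π` in each turn. -/
theorem IsShearPair.exists_angle (hs : IsShearPair h g θ) {r : ℝ} (hr0 : 0 < r)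
    (hr : r ≤ 3 - 2 * Real.sqrt 2) :
    ∃ ψ : ℝ → ℝ, Monotone ψ ∧ (∀ t, ψ (t + 2 * Real.pi) = ψ t + 2 * Real.pi) ∧
      ∀ t : ℝ, velocity h g (r * Complex.exp (t * Complex.I)) =
        ‖velocity h g (r * Complex.exp (t * Complex.I))‖ * Complex.exp (ψ t * Complex.I) := by
  have hr1 : r < 1 := by
    have h2 := Real.sq_sqrt (show (0 : ℝ) ≤ 2 by norm_num)
    have h0 := Real.sqrt_nonneg 2
    nlinarith
  obtain ⟨L, hLd, -, hLe, -⟩ := exists_log_of_ne_zero one_pos (hs.hd.deriv isOpen_ball)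
    fun z hz => hs.deriv_ne_zero hz
  set ζ : ℝ → ℂ := fun t => r * Complex.exp (t * Complex.I) with hζ
  have hζn : ∀ t, ‖ζ t‖ = r := fun t => by
    rw [hζ]
    simp only [norm_mul, Complex.norm_exp_ofReal_mul_I, mul_one, Complex.norm_of_nonneg hr0.le]
  have hζb : ∀ t, ζ t ∈ ball (0 : ℂ) 1 := fun t => by rw [mem_ball_zero_iff, hζn]; exact hr1
  have hζ0 : ∀ t, ζ t ≠ 0 := fun t => norm_pos_iff.1 (by rw [hζn]; exact hr0)
  have hζp : ∀ t, ζ (t + 2 * Real.pi) = ζ t := fun t => by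
    simp only [hζ]
    push_cast
    rw [add_mul, Complex.exp_periodic]
  have hrb : (r : ℂ) ∈ ball (0 : ℂ) 1 := by
    rw [mem_ball_zero_iff, Complex.norm_of_nonneg hr0.le]; exact hr1
  have hζd : ∀ t, DifferentiableAt ℝ ζ t := fun t =>
    (((Complex.ofRealCLM.hasDerivAt.mul_const Complex.I).cexp).const_mul
      (r : ℂ)).differentiableAt
  have hvd : ∀ t : ℝ, HasDerivAt (fun t => velocity h g (ζ t)) (acceleration h g (ζ t)) t :=
    fun t => hasDerivAt_velocity hs.hd hs.gd hrb t
  have hcomp : ∀ {u : ℂ → ℂ}, DifferentiableOn ℂ u (ball 0 1) → ∀ t,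
      DifferentiableAt ℝ (fun t => u (ζ t)) t := fun hu t =>
    ((hu.differentiableAt (isOpen_ball.mem_nhds (hζb t))).restrictScalars ℝ).comp t (hζd t)
  set Q : ℝ → ℂ := fun t => velocity h g (ζ t) / (Complex.I * ζ t * deriv h (ζ t)) with hQ
  have hden : ∀ t, Complex.I * ζ t * deriv h (ζ t) ≠ 0 := fun t =>
    mul_ne_zero (mul_ne_zero Complex.I_ne_zero (hζ0 t)) (hs.deriv_ne_zero (hζb t))
  have hQs : ∀ t, Q t ∈ Complex.slitPlane := fun t => hs.velocity_eq (hζb t) (hζ0 t)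
  have hQd : ∀ t, DifferentiableAt ℝ Q t := fun t =>
    (hvd t).differentiableAt.div (((hζd t).const_mul _).mul
      (hcomp (hs.hd.deriv isOpen_ball) t)) (hden t)
  -- A logarithm of the velocity, read off from the factors r, i, e^{it}, h' and Q. Only the term t
  -- i is not 2π-periodic, so the angle gains exactly 2π per turn.
  set ℓ : ℝ → ℂ := fun t => Real.log r + Real.pi / 2 * Complex.I + t * Complex.I + L (ζ t) +
    Complex.log (Q t) with hℓ
  have hℓd : ∀ t, DifferentiableAt ℝ ℓ t := fun t =>
    ((((differentiableAt_const _).add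
      (Complex.ofRealCLM.differentiableAt.mul_const Complex.I)).add (hcomp hLd t))).add
      ((hQd t).hasDerivAt.clog_real (hQs t)).differentiableAt
  have hexp : ∀ t, Complex.exp (ℓ t) = velocity h g (ζ t) := by
    intro t
    have hne := hs.deriv_ne_zero (hζb t)
    have hne' := hζ0 t
    simp only [hℓ, Complex.exp_add, Complex.exp_log (Complex.slitPlane_ne_zero (hQs t)),
      ← hLe _ (hζb t)]
    rw [Complex.exp_pi_div_two_mul_I, ← Complex.ofReal_exp, Real.exp_log hr0]
    simp only [hQ]
    rw [show (r : ℂ) * Complex.I * Complex.exp (t * Complex.I) * deriv h (ζ t) =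
      Complex.I * ζ t * deriv h (ζ t) by simp only [hζ]; ring]
    field_simp
  have hv0 : ∀ t, velocity h g (ζ t) ≠ 0 := fun t => hexp t ▸ Complex.exp_ne_zero _
  have hψd : ∀ t, HasDerivAt (fun t => (ℓ t).im)
      (acceleration h g (ζ t) / velocity h g (ζ t)).im t := by
    intro t
    have h1 := (hℓd t).hasDerivAt.cexp
    have h2 : HasDerivAt (fun t => Complex.exp (ℓ t)) (acceleration h g (ζ t)) t := by
      rw [show (fun t => Complex.exp (ℓ t)) = fun t => velocity h g (ζ t) from funext hexp]
      exact hvd t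
    have h3 := h1.unique h2
    rw [hexp] at h3
    have h4 : acceleration h g (ζ t) / velocity h g (ζ t) = deriv ℓ t := by
      rw [← h3, mul_div_cancel_left₀ _ (hv0 t)]
    rw [h4]
    exact Complex.imCLM.hasFDerivAt.comp_hasDerivAt t (hℓd t).hasDerivAt
  refine ⟨fun t => (ℓ t).im, ?_, ?_, ?_⟩
  · refine monotone_of_deriv_nonneg (fun t => (hψd t).differentiableAt) fun t => ?_
    rw [(hψd t).deriv]
    have hc := (hs.cross_bounds (hζb t)).1
    rw [hζn] at hc
    have hS := mem_ball_zero_iff.1 (hs.mapsTo_dilatation (hζb t))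
    have h6 := (sq_sub_six_mul_add_one_nonneg_iff hr1).2 hr
    have hr2 : 0 < 1 - r ^ 2 := by nlinarith
    have hS2 : 0 ≤ 1 - ‖shearDilatation h g θ (ζ t)‖ ^ 2 := by
      nlinarith [norm_nonneg (shearDilatation h g θ (ζ t))]
    have hc0 : 0 ≤ cross (velocity h g (ζ t)) (acceleration h g (ζ t)) :=
      le_trans (by positivity) hc
    have : (acceleration h g (ζ t) / velocity h g (ζ t)).im =
        cross (velocity h g (ζ t)) (acceleration h g (ζ t)) /
          Complex.normSq (velocity h g (ζ t)) := by
      rw [Complex.div_im, cross]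
      ring
    rw [this]
    exact div_nonneg hc0 (Complex.normSq_nonneg _)
  · intro t
    simp only [hℓ, hQ, hζp]
    simp
    ring
  · intro t
    change velocity h g (ζ t) = _
    rw [← hexp t, Complex.norm_exp, Complex.ofReal_exp, ← Complex.exp_add, Complex.re_add_im]

theorem harmonicFDeriv_surjective {a b : ℂ} (hab : ‖b‖ < ‖a‖) :
    Function.Surjective (harmonicFDeriv a b) := by
  have hinj : Function.Injective (harmonicFDeriv a b : ℂ →ₗ[ℝ] ℂ) := by
    rw [injective_iff_map_eq_zero]
    intro w hw
    have h1 : w * a + conj (w * b) = 0 := hw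
    by_contra hw0
    have h2 : ‖w * a‖ = ‖w * b‖ := by
      rw [eq_neg_of_add_eq_zero_left h1, norm_neg, RCLike.norm_conj]
    rw [norm_mul, norm_mul] at h2
    exact hab.ne' (mul_left_cancel₀ (norm_ne_zero_iff.2 hw0) h2)
  exact LinearMap.surjective_of_injective hinj

theorem isOpen_image_add_conj {U : Set ℂ} (hU : IsOpen U) (hh : DifferentiableOn ℂ h U)
    (hg : DifferentiableOn ℂ g U) (hlt : ∀ z ∈ U, ‖deriv g z‖ < ‖deriv h z‖) :
    IsOpen ((fun z => h z + conj (g z)) '' U) := by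
  rw [isOpen_iff_mem_nhds]
  rintro _ ⟨z, hz, rfl⟩
  have hn := hU.mem_nhds hz
  have hst : HasStrictFDerivAt (fun z => h z + conj (g z))
      (harmonicFDeriv (deriv h z) (deriv g z)) z :=
    ((hh.analyticAt hn).hasStrictDerivAt.hasStrictFDerivAt.restrictScalars ℝ).add
      ((Complex.conjCLE : ℂ →L[ℝ] ℂ).hasStrictFDerivAt.comp z
        ((hg.analyticAt hn).hasStrictDerivAt.hasStrictFDerivAt.restrictScalars ℝ))
  have := hst.map_nhds_eq_of_surj
    (LinearMap.range_eq_top.2 (harmonicFDeriv_surjective (hlt z hz)))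
  rw [← this]
  exact image_mem_map hn

/-- Each frontier point p of the image comes from the circle |z| = r, where the tangent supports the
image curve. Since Im(c conj g) = -Im(conj c · g), the height over that tangent is the imaginary
part of the analytic function c h - conj c · g up to a constant, so the bound passes from the circle
to the disk. -/
theorem IsShearPair.convex_image_ball (hs : IsShearPair h g θ) {r : ℝ} (hr0 : 0 < r)
    (hr : r ≤ 3 - 2 * Real.sqrt 2) : Convex ℝ ((fun z => h z + conj (g z)) '' ball 0 r) := by
  have hr1 : r < 1 := by
    have h2 := Real.sq_sqrt (show (0 : ℝ) ≤ 2 by norm_num)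
    have h0 := Real.sqrt_nonneg 2
    nlinarith
  have hsub : ball (0 : ℂ) r ⊆ ball 0 1 := ball_subset_ball hr1.le
  have hopen := isOpen_image_add_conj isOpen_ball (hs.hd.mono hsub) (hs.gd.mono hsub)
    fun z hz => hs.norm_lt z (hsub hz)
  obtain ⟨ψ, hψm, hψp, hψ⟩ := hs.exists_angle hr0 hr
  have hrb : (r : ℂ) ∈ ball (0 : ℂ) 1 := by
    rw [mem_ball_zero_iff, Complex.norm_of_nonneg hr0.le]; exact hr1
  have hsphere : ∀ z ∈ sphere (0 : ℂ) r, ∃ t : ℝ, z = r * Complex.exp (t * Complex.I) := by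
    intro z hz
    refine ⟨z.arg, ?_⟩
    have := Complex.norm_mul_exp_arg_mul_I z
    rw [mem_sphere_zero_iff_norm.1 hz] at this
    exact this.symm
  refine convex_of_forall_frontier_support hopen fun p hp => ?_
  have hcl : closure ((fun z => h z + conj (g z)) '' ball 0 r) ⊆
      (fun z => h z + conj (g z)) '' closedBall 0 r := by
    refine closure_minimal (image_mono ball_subset_closedBall) (IsCompact.isClosed ?_)
    have hsc : closedBall (0 : ℂ) r ⊆ ball 0 1 := closedBall_subset_ball hr1
    exact (isCompact_closedBall 0 r).image_of_continuousOn
      ((hs.hd.continuousOn.mono hsc).add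
        (Complex.continuous_conj.comp_continuousOn (hs.gd.continuousOn.mono hsc)))
  rw [hopen.frontier_eq] at hp
  obtain ⟨z₀, hz₀, rfl⟩ := hcl hp.1
  have hz₀s : z₀ ∈ sphere (0 : ℂ) r := by
    rw [mem_sphere_zero_iff_norm]
    refine le_antisymm (mem_closedBall_zero_iff.1 hz₀) ?_
    by_contra! hlt
    exact hp.2 ⟨z₀, mem_ball_zero_iff.2 hlt, rfl⟩
  obtain ⟨t₀, rfl⟩ := hsphere z₀ hz₀s
  set c := Complex.exp (-(ψ t₀ * Complex.I)) with hc
  have hsupp := im_mul_sub_nonneg_of_monotone_angle (fun t => norm_nonneg _)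
    (fun t => by
      have := hasDerivAt_circle hs.hd hs.gd hrb t
      change HasDerivAt _ (velocity h g _) t at this
      rwa [hψ t] at this) hψm hψp (fun t => by
        push_cast
        rw [add_mul, Complex.exp_periodic]) t₀
  refine ⟨c, Complex.exp_ne_zero _, ?_⟩
  rintro _ ⟨z, hz, rfl⟩
  set p := h (r * Complex.exp (t₀ * Complex.I)) + conj (g (r * Complex.exp (t₀ * Complex.I)))
  have him : ∀ z, (c * (h z + conj (g z) - p)).im =
      (c * h z - conj c * g z).im - (c * p).im := by
    intro z
    simp only [Complex.mul_im, Complex.sub_im, Complex.add_im, Complex.sub_re, Complex.add_re,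
      Complex.conj_re, Complex.conj_im]
    ring
  have hmax := le_im_on_ball_of_le_im_on_sphere (F := fun z => c * h z - conj c * g z)
    (m := (c * p).im) ((hs.hd.const_mul c).sub (hs.gd.const_mul _)) hr0.ne' hr1
    (fun w hw => by
      obtain ⟨t, rfl⟩ := hsphere w hw
      have := hsupp t
      rw [him] at this
      linarith) hz
  change 0 ≤ (c * (h z + conj (g z) - p)).im
  rw [him]
  linarith

theorem isConvexDomain_image_ball {f : ℂ → ℂ} (hf : f ∈ classSHS) {R : ℝ} (hR0 : 0 < R)
    (hR : R ≤ 3 - 2 * Real.sqrt 2) : IsConvexDomain (f '' ball 0 R) := by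
  obtain ⟨f₀, hf₀, b, hb, hf⟩ := hf
  obtain ⟨h, g, θ, hs, hd⟩ := exists_isShearPair hf₀
  have hR1 : R < 1 := by
    have h2 := Real.sq_sqrt (show (0 : ℝ) ≤ 2 by norm_num)
    have h0 := Real.sqrt_nonneg 2
    nlinarith
  have hsub : ball (0 : ℂ) R ⊆ ball 0 1 := ball_subset_ball hR1.le
  have hconv := hs.convex_image_ball hR0 hR
  have hopen := isOpen_image_add_conj isOpen_ball (hs.hd.mono hsub) (hs.gd.mono hsub)
    fun z hz => hs.norm_lt z (hsub hz)
  have hb1 : ‖conj b‖ < ‖(1 : ℂ)‖ := by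
    rw [RCLike.norm_conj, norm_one]; exact mem_ball_zero_iff.1 hb
  have heq : f '' ball 0 R =
      harmonicFDeriv 1 (conj b) '' ((fun z => h z + conj (g z)) '' ball 0 R) := by
    rw [image_image]
    refine image_congr fun z hz => ?_
    rw [hf z (hsub hz), hd.eq_add_conj z (hsub hz), harmonicFDeriv_apply, map_mul,
      Complex.conj_conj]
    ring
  rw [heq]
  exact ⟨(harmonicFDeriv 1 (conj b)).isOpenMap (harmonicFDeriv_surjective hb1) _ hopen,
    ((nonempty_ball.2 hR0).image _).image _,
    hconv.linear_image (harmonicFDeriv 1 (conj b) : ℂ →ₗ[ℝ] ℂ)⟩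

end Convexity

/-! ### The harmonic Koebe function and sharpness of the radius -/

/-- The analytic part of the harmonic Koebe function. -/
noncomputable def koebeAnalytic (z : ℂ) : ℂ := (z - z ^ 2 / 2 + z ^ 3 / 6) / (1 - z) ^ 3

/-- The co-analytic part of the harmonic Koebe function. -/
noncomputable def koebeCoanalytic (z : ℂ) : ℂ := (z ^ 2 / 2 + z ^ 3 / 6) / (1 - z) ^ 3

/-- The harmonic Koebe function. -/
noncomputable def harmonicKoebe (z : ℂ) : ℂ := koebeAnalytic z + conj (koebeCoanalytic z)

section HarmonicKoebe

open Metric Set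

theorem one_sub_ne_zero_of_norm_lt_one {z : ℂ} (hz : ‖z‖ < 1) : 1 - z ≠ 0 := by
  intro h
  rw [← sub_eq_zero.1 h] at hz
  simp at hz

theorem hasDerivAt_koebeAnalytic {z : ℂ} (hz : ‖z‖ < 1) :
    HasDerivAt koebeAnalytic ((1 + z) / (1 - z) ^ 4) z := by
  have hne := one_sub_ne_zero_of_norm_lt_one hz
  have h := ((((hasDerivAt_id z).fun_sub (((hasDerivAt_id z).fun_pow 2).div_const 2)).fun_add
    (((hasDerivAt_id z).fun_pow 3).div_const 6))).fun_div
    (((hasDerivAt_id z).const_sub 1).fun_pow 3) (pow_ne_zero 3 hne)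
  refine h.congr_deriv ?_
  simp only [id]
  field_simp
  ring

theorem hasDerivAt_koebeCoanalytic {z : ℂ} (hz : ‖z‖ < 1) :
    HasDerivAt koebeCoanalytic (z * ((1 + z) / (1 - z) ^ 4)) z := by
  have hne := one_sub_ne_zero_of_norm_lt_one hz
  have h := ((((hasDerivAt_id z).fun_pow 2).div_const 2).fun_add
    (((hasDerivAt_id z).fun_pow 3).div_const 6)).fun_div
    (((hasDerivAt_id z).const_sub 1).fun_pow 3) (pow_ne_zero 3 hne)
  refine h.congr_deriv ?_
  simp only [id]
  field_simp
  ring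

theorem isDecomposition_harmonicKoebe :
    IsDecomposition harmonicKoebe koebeAnalytic koebeCoanalytic where
  analytic_part := fun _ hz => (hasDerivAt_koebeAnalytic
    (mem_ball_zero_iff.1 hz)).differentiableAt.differentiableWithinAt
  coanalytic_part := fun _ hz => (hasDerivAt_koebeCoanalytic
    (mem_ball_zero_iff.1 hz)).differentiableAt.differentiableWithinAt
  h_zero := by simp [koebeAnalytic]
  g_zero := by simp [koebeCoanalytic]
  deriv_h_zero := by rw [(hasDerivAt_koebeAnalytic (by simp)).deriv]; simp
  eq_add_conj := fun _ _ => rfl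

/-- The Cayley map from the unit disk onto the right half plane. -/
noncomputable def cayley (z : ℂ) : ℂ := (1 + z) / (1 - z)

/-- With w the Cayley transform, h + g = (w³ - 1)/6, and h + conj g has the same real part as h + g.
The imaginary part comes likewise from h - g = (w² - 1)/4. -/
theorem harmonicKoebe_re {z : ℂ} (hz : ‖z‖ < 1) :
    (harmonicKoebe z).re = ((cayley z).re ^ 3 - 3 * (cayley z).re * (cayley z).im ^ 2 - 1) / 6 := by
  have hne := one_sub_ne_zero_of_norm_lt_one hz
  have h1 : koebeAnalytic z + koebeCoanalytic z = ((1 / 6 : ℝ) : ℂ) * (cayley z ^ 3 - 1) := by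
    rw [koebeAnalytic, koebeCoanalytic, cayley]
    push_cast
    field_simp
    ring
  have h2 : (harmonicKoebe z).re = (koebeAnalytic z + koebeCoanalytic z).re := by
    simp [harmonicKoebe]
  rw [h2, h1, Complex.re_ofReal_mul]
  simp [pow_succ]
  ring

theorem harmonicKoebe_im {z : ℂ} (hz : ‖z‖ < 1) :
    (harmonicKoebe z).im = (cayley z).re * (cayley z).im / 2 := by
  have hne := one_sub_ne_zero_of_norm_lt_one hz
  have h1 : koebeAnalytic z - koebeCoanalytic z = ((1 / 4 : ℝ) : ℂ) * (cayley z ^ 2 - 1) := by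
    rw [koebeAnalytic, koebeCoanalytic, cayley]
    push_cast
    field_simp
    ring
  have h2 : (harmonicKoebe z).im = (koebeAnalytic z - koebeCoanalytic z).im := by
    simp [harmonicKoebe, sub_eq_add_neg]
  rw [h2, h1, Complex.im_ofReal_mul]
  simp [pow_succ]
  ring

theorem cayley_re_pos {z : ℂ} (hz : ‖z‖ < 1) : 0 < (cayley z).re := by
  have hne := Complex.normSq_pos.2 (one_sub_ne_zero_of_norm_lt_one hz)
  have h1 : (cayley z).re = (1 - Complex.normSq z) / Complex.normSq (1 - z) := by
    rw [cayley, Complex.div_re, ← add_div]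
    congr 1
    simp [Complex.normSq_apply]
    ring
  rw [h1]
  refine div_pos ?_ hne
  rw [Complex.normSq_eq_norm_sq]
  nlinarith [norm_nonneg z]

theorem cayley_injOn : InjOn cayley (ball 0 1) := by
  intro z hz w hw h
  rw [cayley, cayley, div_eq_div_iff
    (one_sub_ne_zero_of_norm_lt_one (mem_ball_zero_iff.1 hz))
    (one_sub_ne_zero_of_norm_lt_one (mem_ball_zero_iff.1 hw))] at h
  linear_combination h / 2

theorem injOn_harmonicKoebe : InjOn harmonicKoebe (ball 0 1) := by
  intro z hz w hw h
  have hz1 := mem_ball_zero_iff.1 hz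
  have hw1 := mem_ball_zero_iff.1 hw
  have hre := congrArg Complex.re h
  have him := congrArg Complex.im h
  rw [harmonicKoebe_re hz1, harmonicKoebe_re hw1] at hre
  rw [harmonicKoebe_im hz1, harmonicKoebe_im hw1] at him
  have hu := cayley_re_pos hz1
  have hu' := cayley_re_pos hw1
  refine cayley_injOn hz hw (Complex.ext ?_ ?_)
  all_goals
    set u := (cayley z).re
    set v := (cayley z).im
    set u' := (cayley w).re
    set v' := (cayley w).im
    -- For a fixed product k = uv the real part is governed by u³ - 3k²/u, strictly increasing in u
    -- > 0. This is that monotonicity with denominators cleared.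
    have huu : (u - u') * (u * u' * (u ^ 2 + u * u' + u' ^ 2) + 3 * (u * v) ^ 2) = 0 := by
      linear_combination (6 * u * u') * hre + (6 * u * (u * v + u' * v')) * him
    have hpos : 0 < u * u' * (u ^ 2 + u * u' + u' ^ 2) + 3 * (u * v) ^ 2 := by positivity
    have hueq : u = u' := sub_eq_zero.1 ((mul_eq_zero.1 huu).resolve_right hpos.ne')
  · exact hueq
  · rw [← hueq] at him
    exact mul_left_cancel₀ hu.ne' (by linarith)

/-- With θ = π the shear h - g is the classical Koebe function z/(1 - z)², the dilatation g'/h' is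
z, and b = 0. -/
theorem harmonicKoebe_mem_classSHS : harmonicKoebe ∈ classSHS := by
  have hd := isDecomposition_harmonicKoebe
  have hk : ∀ z ∈ ball (0 : ℂ) 1,
      koebeAnalytic z + Complex.exp ((Real.pi : ℝ) * Complex.I) * koebeCoanalytic z =
        z / (1 - z) ^ 2 := by
    intro z hz
    have hne := one_sub_ne_zero_of_norm_lt_one (mem_ball_zero_iff.1 hz)
    rw [Complex.exp_pi_mul_I, koebeAnalytic, koebeCoanalytic]
    field_simp
    ring
  refine ⟨harmonicKoebe, ⟨⟨⟨koebeAnalytic, koebeCoanalytic, hd, ?_, injOn_harmonicKoebe⟩, ?_⟩,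
    koebeAnalytic, koebeCoanalytic, hd, Real.pi, ?_, ?_, ?_, ?_⟩, 0, mem_ball_self one_pos, by simp⟩
  · intro z hz
    have hz1 := mem_ball_zero_iff.1 hz
    rw [(hasDerivAt_koebeAnalytic hz1).deriv, (hasDerivAt_koebeCoanalytic hz1).deriv, norm_mul]
    have h1 : (1 + z) / (1 - z) ^ 4 ≠ 0 := by
      refine div_ne_zero ?_ (pow_ne_zero 4 (one_sub_ne_zero_of_norm_lt_one hz1))
      have := one_sub_ne_zero_of_norm_lt_one (z := -z) (by rwa [norm_neg])
      rwa [sub_neg_eq_add] at this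
    have h2 := pow_pos (norm_pos_iff.2 h1) 2
    have h3 : 0 < 1 - ‖z‖ ^ 2 := by nlinarith [norm_nonneg z]
    nlinarith [mul_pos h2 h3]
  · rw [wirtingerBar_eq (hd.hasFDerivAt (mem_ball_self one_pos)),
      (hasDerivAt_koebeCoanalytic (by simp)).deriv]
    simp
  · exact hd.analytic_part.add (hd.coanalytic_part.const_mul _)
  · intro z hz w hw h
    have hz1 := mem_ball_zero_iff.1 hz
    have hw1 := mem_ball_zero_iff.1 hw
    simp only [hk z hz, hk w hw] at h
    rw [div_eq_div_iff (pow_ne_zero 2 (one_sub_ne_zero_of_norm_lt_one hz1))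
      (pow_ne_zero 2 (one_sub_ne_zero_of_norm_lt_one hw1))] at h
    have h1 : (z - w) * (1 - z * w) = 0 := by linear_combination h
    refine sub_eq_zero.1 ((mul_eq_zero.1 h1).resolve_right (one_sub_ne_zero_of_norm_lt_one ?_))
    rw [norm_mul]
    nlinarith [norm_nonneg z, norm_nonneg w]
  · simp [koebeAnalytic, koebeCoanalytic]
  · refine (((hasDerivAt_koebeAnalytic (by simp)).fun_add
      ((hasDerivAt_koebeCoanalytic (by simp)).const_mul _)).deriv).trans ?_
    simp

/-- In the half plane the disk `|z| < (1 - a) / (1 + a)` becomes a disk with diameter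
`(a, 1 / a)`. -/
theorem norm_lt_iff_cayley {z : ℂ} (hz : ‖z‖ < 1) {a : ℝ} (ha0 : 0 ≤ a) (ha1 : a < 1) :
    ‖z‖ < (1 - a) / (1 + a) ↔
      a * (cayley z).im ^ 2 < ((cayley z).re - a) * (1 - a * (cayley z).re) := by
  have hne := one_sub_ne_zero_of_norm_lt_one hz
  have hw1 : (cayley z + 1) * (1 - z) = 2 := by
    rw [cayley]; field_simp; ring
  have hw2 : (cayley z + 1) * z = cayley z - 1 := by
    rw [cayley]; field_simp; ring
  have hpos : 0 < Complex.normSq (cayley z + 1) := by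
    rw [Complex.normSq_pos]
    intro h0
    rw [h0, zero_mul] at hw1
    norm_num at hw1
  have hz2 : Complex.normSq z * Complex.normSq (cayley z + 1) = Complex.normSq (cayley z - 1) := by
    rw [← hw2, Complex.normSq_mul, mul_comm]
  have h1a : 0 < 1 + a := by linarith
  rw [lt_div_iff₀ h1a, ← sq_lt_sq₀ (by positivity) (by linarith), mul_pow,
    ← Complex.normSq_eq_norm_sq, ← mul_lt_mul_iff_of_pos_right hpos, mul_right_comm, hz2]
  simp only [Complex.normSq_apply, Complex.add_re, Complex.sub_re, Complex.add_im, Complex.sub_im,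
    Complex.one_re, Complex.one_im]
  constructor <;> intro h <;> nlinarith

theorem exists_cayley_eq {w : ℂ} (hw : 0 < w.re) : ∃ z : ℂ, ‖z‖ < 1 ∧ cayley z = w := by
  have hne : w + 1 ≠ 0 := by
    intro h
    have := congrArg Complex.re h
    simp at this
    linarith
  refine ⟨(w - 1) / (w + 1), ?_, ?_⟩
  · rw [norm_div, div_lt_one (norm_pos_iff.2 hne), ← sq_lt_sq₀ (norm_nonneg _) (norm_nonneg _),
      ← Complex.normSq_eq_norm_sq, ← Complex.normSq_eq_norm_sq]
    simp only [Complex.normSq_apply, Complex.add_re, Complex.sub_re, Complex.add_im,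
      Complex.sub_im, Complex.one_re, Complex.one_im]
    nlinarith
  · rw [cayley]
    have : (1 : ℂ) - (w - 1) / (w + 1) ≠ 0 := by
      rw [show (1 : ℂ) - (w - 1) / (w + 1) = 2 / (w + 1) by field_simp; ring]
      exact div_ne_zero two_ne_zero hne
    rw [div_eq_iff this]
    field_simp
    ring

/-- Let a = (1 - R)/(1 + R) be the Cayley image of -R. The condition on R says 2a² < 1. Then the
curve Re w³ = a³ through a enters the transformed disk at conjugate points u ± iv. Their images have
the real midpoint (a³ - 1)/6, which could only be attained at w = a, on the boundary of the disk. -/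
theorem not_convex_image_harmonicKoebe {R : ℝ} (hR : 3 - 2 * Real.sqrt 2 < R) (hR1 : R ≤ 1) :
    ¬ Convex ℝ (harmonicKoebe '' ball 0 R) := by
  intro hconv
  have h2 := Real.sq_sqrt (show (0 : ℝ) ≤ 2 by norm_num)
  have h20 := Real.sqrt_nonneg 2
  have hR0 : 0 < R := by nlinarith
  obtain ⟨a, ha⟩ : ∃ a, a = (1 - R) / (1 + R) := ⟨_, rfl⟩
  have haR : R = (1 - a) / (1 + a) := by
    rw [ha]; field_simp; ring
  have ha0 : 0 ≤ a := by rw [ha]; exact div_nonneg (by linarith) (by linarith)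
  have ha2 : 2 * a ^ 2 < 1 := by
    rw [ha, div_pow, ← mul_div_assoc, div_lt_one (by positivity)]
    nlinarith
  have ha1 : a < 1 := by nlinarith
  -- Any u > a with 4au + 2a² < 3 would do. At u = a this reads 2a² < 1, and this offset is small
  -- enough to preserve it.
  obtain ⟨u, hu⟩ : ∃ u, u = a + (1 - 2 * a ^ 2) / 2 := ⟨_, rfl⟩
  have hau : a < u := by rw [hu]; linarith
  have hu0 : 0 < u := ha0.trans_lt hau
  have hq : 0 ≤ (u - a) * (u ^ 2 + u * a + a ^ 2) / (3 * u) := by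
    have := sub_pos.2 hau
    positivity
  -- Solves Re (u + iv)³ = u³ - 3uv² = a³.
  obtain ⟨v, hv⟩ : ∃ v, v = Real.sqrt ((u - a) * (u ^ 2 + u * a + a ^ 2) / (3 * u)) := ⟨_, rfl⟩
  have hv2 : 3 * u * v ^ 2 = u ^ 3 - a ^ 3 := by
    rw [hv, Real.sq_sqrt hq]
    field_simp
    ring
  have hin : a * v ^ 2 < (u - a) * (1 - a * u) := by
    have h1 : 4 * a * u + 2 * a ^ 2 < 3 := by rw [hu]; nlinarith
    have h3 : a * (u ^ 2 + u * a + a ^ 2) < 3 * u * (1 - a * u) := by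
      have h4 : a ^ 3 ≤ a ^ 2 * u := by
        have := mul_le_mul_of_nonneg_left hau.le (sq_nonneg a)
        linarith [pow_succ a 2]
      have h5 := mul_lt_mul_of_pos_right h1 hu0
      nlinarith
    have h6 := mul_lt_mul_of_pos_left h3 (sub_pos.2 hau)
    have h7 : (3 * u) * (a * v ^ 2) < (3 * u) * ((u - a) * (1 - a * u)) := by
      have : (3 * u) * (a * v ^ 2) = (u - a) * (a * (u ^ 2 + u * a + a ^ 2)) := by
        linear_combination a * hv2
      rw [this]
      linarith
    exact lt_of_mul_lt_mul_left h7 (by positivity)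
  have hpt : ∀ y : ℝ, y ^ 2 = v ^ 2 → ∃ p ∈ harmonicKoebe '' ball 0 R,
      p.re = (a ^ 3 - 1) / 6 ∧ p.im = u * y / 2 := by
    intro y hy
    obtain ⟨z, hz, hzw⟩ := exists_cayley_eq (w := ⟨u, y⟩) hu0
    refine ⟨_, ⟨z, ?_, rfl⟩, ?_, ?_⟩
    · rw [mem_ball_zero_iff, haR, norm_lt_iff_cayley hz ha0 ha1, hzw]
      simp only [hy]
      exact hin
    · rw [harmonicKoebe_re hz, hzw]
      simp only [hy]
      rw [hv2]
      ring
    · rw [harmonicKoebe_im hz, hzw]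
  obtain ⟨p, hp, hpr, hpi⟩ := hpt v rfl
  obtain ⟨q, hq, hqr, hqi⟩ := hpt (-v) (neg_sq v)
  obtain ⟨z, hz, hzm⟩ := hconv hp hq (show (0 : ℝ) ≤ 1 / 2 by norm_num)
    (show (0 : ℝ) ≤ 1 / 2 by norm_num) (by norm_num)
  rw [mem_ball_zero_iff] at hz
  have hz1 : ‖z‖ < 1 := hz.trans_le hR1
  have hre := congrArg Complex.re hzm
  have him := congrArg Complex.im hzm
  rw [harmonicKoebe_re hz1, Complex.add_re, Complex.smul_re, Complex.smul_re, hpr, hqr] at hre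
  rw [harmonicKoebe_im hz1, Complex.add_im, Complex.smul_im, Complex.smul_im, hpi, hqi] at him
  rw [haR, norm_lt_iff_cayley hz1 ha0 ha1] at hz
  have hx := cayley_re_pos hz1
  set x := (cayley z).re
  have hy : (cayley z).im = 0 := by
    have : x * (cayley z).im = 0 := by
      simp only [smul_eq_mul] at him
      linarith
    exact (mul_eq_zero.1 this).resolve_left hx.ne'
  rw [hy] at hre hz
  simp only [smul_eq_mul] at hre
  have hxa : x ^ 3 = a ^ 3 := by linarith
  have hxa' : x = a := (pow_left_inj₀ hx.le ha0 three_ne_zero).1 hxa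
  rw [hxa'] at hz
  simp at hz

end HarmonicKoebe

/-- Identifies b₁ with b: the co-analytic part of f is g + conj b · h, whose derivative at 0 is conj
b. -/
theorem wirtingerBar_of_affine {f f₀ h g : ℂ → ℂ} {b : ℂ} {θ : ℝ} (hs : IsShearPair h g θ)
    (hd : IsDecomposition f₀ h g) (hf : ∀ z ∈ unitDisk, f z = f₀ z + b * conj (f₀ z)) :
    wirtingerBar f 0 = b := by
  have h0 : (0 : ℂ) ∈ Metric.ball (0 : ℂ) 1 := Metric.mem_ball_self one_pos
  have hn := Metric.isOpen_ball.mem_nhds h0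
  have hh := (hs.hd.differentiableAt hn).hasDerivAt
  have hg := (hs.gd.differentiableAt hn).hasDerivAt
  have hF := (hasFDerivAt_add_conj (hh.fun_add (hg.const_mul b))
    (hg.fun_add (hh.const_mul (conj b)))).congr_of_eventuallyEq (f₁ := f) (by
      filter_upwards [hn] with z hz
      rw [hf z hz, hd.eq_add_conj z hz]
      simp only [map_add, map_mul, Complex.conj_conj]
      ring)
  rw [wirtingerBar_eq hF, hs.deriv_g_zero, hs.deriv_h_zero]
  simp

end HarmonicUnivalent

theorem mainTheorem6 :
    (∀ f ∈ HarmonicUnivalent.classSHS, ∀ b₁ : ℂ, b₁ = HarmonicUnivalent.wirtingerBar f 0 →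
      ∀ ρ : ℝ, ρ = 3 - 2 * Real.sqrt 2 →
        (∀ (z : ℂ) (r : ℝ), r = ‖z‖ → 0 < r → r < 1 →
          HarmonicUnivalent.circleImageCurvature f z ≤
              (1 + ‖b₁‖) / (1 - ‖b₁‖) ^ 2 * ((1 + r) / (1 - r)) ^ 4 * ((r ^ 2 + 6 * r + 1) / r) ∧
            (r ≤ ρ →
              (1 - ‖b₁‖) / (1 + ‖b₁‖) ^ 2 * ((1 - r) / (1 + r)) ^ 4 * ((r ^ 2 - 6 * r + 1) / r) ≤
                HarmonicUnivalent.circleImageCurvature f z) ∧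
            (ρ < r →
              (1 + ‖b₁‖) / (1 - ‖b₁‖) ^ 2 * ((1 + r) / (1 - r)) ^ 4 * ((r ^ 2 - 6 * r + 1) / r) ≤
                HarmonicUnivalent.circleImageCurvature f z)) ∧
        HarmonicUnivalent.IsConvexDomain (f '' Metric.ball 0 ρ)) ∧
    HarmonicUnivalent.IsRadiusOfConvexity HarmonicUnivalent.classSHS (3 - 2 * Real.sqrt 2) := by
  have h2 := Real.sq_sqrt (show (0 : ℝ) ≤ 2 by norm_num)
  have h20 := Real.sqrt_nonneg 2
  have hρ0 : 0 < 3 - 2 * Real.sqrt 2 := by nlinarith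
  refine ⟨fun f hf b₁ hb₁ ρ hρ => ⟨?_, ?_⟩, hρ0, by nlinarith, fun R hR0 hR1 => ⟨fun h => ?_,
    fun hR f hf => HarmonicUnivalent.isConvexDomain_image_ball hf hR0 hR⟩⟩
  · obtain ⟨f₀, hf₀, b, hb, hfb⟩ := hf
    obtain ⟨h, g, θ, hs, hd⟩ := HarmonicUnivalent.exists_isShearPair hf₀
    rw [HarmonicUnivalent.wirtingerBar_of_affine hs hd hfb] at hb₁
    intro z r hzr hr0 hr1
    rw [hb₁, hρ]
    exact HarmonicUnivalent.curvature_bounds hs hd (mem_ball_zero_iff.1 hb) hfb hzr hr0 hr1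
  · rw [hρ]
    exact HarmonicUnivalent.isConvexDomain_image_ball hf hρ0 le_rfl
  · by_contra! hR
    exact HarmonicUnivalent.not_convex_image_harmonicKoebe hR hR1
      (h _ HarmonicUnivalent.harmonicKoebe_mem_classSHS).2.2
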